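/- Let $\mathcal M$ be a smooth (finite-dimensional) Riemannian manifold without boundary, let $q\in\mathcal M$, and let $r_{\mathcal M}(q)\in(0,\infty]$ be the injectivity radius at $q$, i.e. the supremum of all $a$ such that the Riemannian exponential map $\operatorname{Exp}_q$ is defined on the open ball of radius $a$ around $0$ in $T_q\mathcal M$ and is a diffeomorphism from this ball onto an open subset of $\mathcal M$. Then there are a function $\eta:\mathbb R\to\mathbb R$ with $\eta(\delta)=o(\delta^2)$ as $\delta\to 0^+$ and a constant $C\in\mathbb R$, both depending only on $\mathcal M$ and $q$, such that the following holds. Let $\Delta,\tilde\Delta\in T_q\mathcal M$ be linearly independent tangent vectors with norms $\delta=\|\Delta\|<1$ and $\tilde\delta=\|\tilde\Delta\|<1$ and with $\delta,\tilde\delta<r_{\mathcal M}(q)$; let $s_0=\angle(\Delta,\tilde\Delta)$ be the angle between them, let $\sigma=\operatorname{span}(\Delta,\tilde\Delta)$ be the $2$-plane they span, and let $K_q(\sigma)$ be the sectional curvature of $\mathcal M$ at $q$ with respect to $\sigma$. Then the Riemannian distance between $p=\operatorname{Exp}_q(\Delta)$ and $\tilde p=\operatorname{Exp}_q(\tilde\Delta)$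 is finite and satisfies \[ \operatorname{dist}_{\mathcal M}(p,\tilde p)\;\le\; |\delta-\tilde\delta| + s_0\,\delta\Bigl(1-\frac{K_q(\sigma)}{6}\,\delta^2+\eta(\delta)\Bigr)+C\,s_0^2 . \] -/

import Mathlib

noncomputable section

namespace RiemannianGeometry

section Coordinates

variable {E : Type*} [NormedAddCommGroup E] [NormedSpace ℝ E]

/-- The Christoffel symbols of the first kind of a metric `g` given in coordinates, as the linear
form `w ↦ (∂_u g(v, w) + ∂_v g(u, w) - ∂_w g(u, v)) / 2` at the point `y`. -/
def christoffelForm (g : E → E →L[ℝ] E →L[ℝ] ℝ) (y u v : E) : E →L[ℝ] ℝ :=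
  let D : E →L[ℝ] E →L[ℝ] E →L[ℝ] ℝ := fderiv ℝ g y
  (1 / 2 : ℝ) • (D u v + D v u - (D.flip u).flip v)

/-- The Christoffel symbols of the Levi-Civita connection of a metric `g` given in coordinates:
`Γ_y(u, v)` is the vector such that
`g_y(Γ_y(u, v), w) = (∂_u g(v, w) + ∂_v g(u, w) - ∂_w g(u, v)) / 2` for all `w`. -/
def christoffel (g : E → E →L[ℝ] E →L[ℝ] ℝ) (y u v : E) : E :=
  (g y).inverse (christoffelForm g y u v)

/-- The Riemann curvature tensor of a metric `g` given in coordinates, with the sign convention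
`R(u, v)w = ∇_u ∇_v w - ∇_v ∇_u w - ∇_[u, v] w`, computed on constant vector fields. -/
def curvature (g : E → E →L[ℝ] E →L[ℝ] ℝ) (y u v w : E) : E :=
  fderiv ℝ (fun z ↦ christoffel g z v w) y u - fderiv ℝ (fun z ↦ christoffel g z u w) y v
    + christoffel g y u (christoffel g y v w) - christoffel g y v (christoffel g y u w)

/-- The sectional curvature at `y` of the plane spanned by the linearly independent vectors `u, v`,
for a metric `g` given in coordinates: `⟨R(u, v)v, u⟩ / (|u|² |v|² - ⟨u, v⟩²)`. -/
def coordSectionalCurvature (g : E → E →L[ℝ] E →L[ℝ] ℝ) (y u v : E) : ℝ :=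
  g y (curvature g y u v v) u / (g y u u * g y v v - g y u v ^ 2)

end Coordinates

end RiemannianGeometry

end

open Bundle Manifold Set
open scoped ContDiff Topology ENNReal NNReal

noncomputable section

namespace RiemannianGeometry

variable {E : Type*} [NormedAddCommGroup E] [NormedSpace ℝ E]
  {H : Type*} [TopologicalSpace H] (I : ModelWithCorners ℝ E H)
  {M : Type*} [TopologicalSpace M] [ChartedSpace H M]

variable [IsManifold I 1 M]

/-- The coordinates of a tangent vector `v` at `x` in the preferred chart `φ` at `x`: the
trivialization of the tangent bundle induced by `φ`, that is `dφ_x v`. -/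
def coordVector (x : M) (v : TangentSpace I x) : E :=
  (trivializationAt E (TangentSpace I : M → Type _) x).continuousLinearMapAt ℝ x v

variable [RiemannianBundle (fun x : M ↦ TangentSpace I x)]

/-- The metric tensor in the preferred chart `φ` at `x₀`, at the point `x = φ⁻¹ y` with coordinates
`y`: the inner product at `x` of the tangent vectors with coordinates `u` and `v` in `φ`. -/
def chartMetric (x₀ : M) (y : E) : E →L[ℝ] E →L[ℝ] ℝ :=
  let x : M := (extChartAt I x₀).symm y
  let A : E →L[ℝ] TangentSpace I x :=
    (trivializationAt E (TangentSpace I : M → Type _) x₀).symmL ℝ x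
  (ContinuousLinearMap.precomp ℝ A) ∘L
    (RiemannianBundle.g (E := fun x : M ↦ TangentSpace I x)).inner x ∘L A

theorem chartMetric_apply (x₀ : M) (y u v : E) :
    chartMetric I x₀ y u v =
      inner ℝ
        ((trivializationAt E (TangentSpace I : M → Type _) x₀).symmL ℝ
          ((extChartAt I x₀).symm y) u)
        ((trivializationAt E (TangentSpace I : M → Type _) x₀).symmL ℝ
          ((extChartAt I x₀).symm y) v) :=
  rfl

/-- The sectional curvature at `q` of the plane spanned by the linearly independent tangent
vectors `Δ₁, Δ₂`, computed in the preferred chart at `q`. -/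
def sectionalCurvature (q : M) (Δ₁ Δ₂ : TangentSpace I q) : ℝ :=
  coordSectionalCurvature (chartMetric I q) (extChartAt I q q)
    (coordVector I q Δ₁) (coordVector I q Δ₂)

/-- `c` is smooth around every time of `[0, 1]` and satisfies there the geodesic equation
`c'' + Γ(c', c') = 0`, in every preferred chart around the point. -/
def IsGeodesic (c : ℝ → M) : Prop :=
  ∀ t ∈ Icc (0 : ℝ) 1, ContMDiffAt 𝓘(ℝ, ℝ) I ∞ c t ∧
    ∀ x₀ : M, c t ∈ (extChartAt I x₀).source →
      let u : ℝ → E := fun s ↦ extChartAt I x₀ (c s)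
      deriv (deriv u) t + christoffel (chartMetric I x₀) (u t) (deriv u t) (deriv u t) = 0

/-- `c` is a geodesic on `[0, 1]` that starts at `q` with velocity `v`. -/
def IsGeodesicFrom (q : M) (v : TangentSpace I q) (c : ℝ → M) : Prop :=
  IsGeodesic I c ∧ c 0 = q ∧ deriv (fun s ↦ extChartAt I q (c s)) 0 = coordVector I q v

/-- The domain of the Riemannian exponential map at `q`. -/
def expDomain (q : M) : Set (TangentSpace I q) :=
  {v | ∃ c : ℝ → M, IsGeodesicFrom I q v c}

open Classical in
/-- The Riemannian exponential map at `q`: the endpoint `c 1` of the geodesic `c` that starts at `q`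
with velocity `v`. Outside `expDomain I q` it takes the junk value `q`. -/
def Exp (q : M) (v : TangentSpace I q) : M :=
  if h : ∃ c : ℝ → M, IsGeodesicFrom I q v c then h.choose 1 else q

/-- `Exp_q` is defined on the open ball of radius `a` around the origin of the tangent space at `q`
and is a diffeomorphism from it onto an open subset of the manifold. -/
def IsDiffeoOnBall (q : M) (a : ℝ) : Prop :=
  Metric.ball (0 : TangentSpace I q) a ⊆ expDomain I q ∧
  ∃ Φ : OpenPartialHomeomorph (TangentSpace I q) M,
    Φ.source = Metric.ball (0 : TangentSpace I q) a ∧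
    EqOn Φ (Exp I q) Φ.source ∧
    ContMDiffOn 𝓘(ℝ, TangentSpace I q) I ∞ Φ Φ.source ∧
    ContMDiffOn I 𝓘(ℝ, TangentSpace I q) ∞ Φ.symm Φ.target

/-- The injectivity radius at `q`: the supremum, in `[0, ∞]`, of the radii `a` for which `Exp_q` is
a diffeomorphism from the open ball of radius `a` onto its image. -/
def injectivityRadius (q : M) : ℝ≥0∞ :=
  ⨆ (a : ℝ≥0) (_ : IsDiffeoOnBall I q a), (a : ℝ≥0∞)

end RiemannianGeometry

end

noncomputable section

set_option maxSynthPendingDepth 3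
set_option synthInstance.maxHeartbeats 200000
set_option maxHeartbeats 1000000

namespace RiemannianGeometry

section Coordinates

variable {E : Type*} [NormedAddCommGroup E] [NormedSpace ℝ E]

/-- The function `g` is a smooth nondegenerate symmetric bilinear form on the open set `U`. -/
structure IsMetricOn (g : E → E →L[ℝ] E →L[ℝ] ℝ) (U : Set E) : Prop where
  isOpen : IsOpen U
  contDiffOn : ContDiffOn ℝ ∞ g U
  symm : ∀ y ∈ U, ∀ u v, g y u v = g y v u
  isInvertible : ∀ y ∈ U, (g y).IsInvertible

/-- The trilinear form `(u, v, w) ↦ (D u v w + D v u w - D w u v) / 2`. -/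
def christoffelTrilin (D : E →L[ℝ] E →L[ℝ] E →L[ℝ] ℝ) : E →L[ℝ] E →L[ℝ] E →L[ℝ] ℝ :=
  (1 / 2 : ℝ) • (D + D.flip
    - (ContinuousLinearMap.flipₗᵢ ℝ E E ℝ).toContinuousLinearEquiv.toContinuousLinearMap ∘L D.flip)

/-- The Christoffel symbols as a bilinear map. -/
def christoffelCLM (g : E → E →L[ℝ] E →L[ℝ] ℝ) (y : E) : E →L[ℝ] E →L[ℝ] E :=
  (ContinuousLinearMap.compL ℝ E (E →L[ℝ] ℝ) E (g y).inverse) ∘L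
    christoffelTrilin (fderiv ℝ g y)

theorem christoffelCLM_apply (g : E → E →L[ℝ] E →L[ℝ] ℝ) (y u v : E) :
    christoffelCLM g y u v = christoffel g y u v := rfl

theorem two_le_infty : (2 : ℕ∞ω) ≤ ((⊤ : ℕ∞) : ℕ∞ω) :=
  WithTop.coe_le_coe.2 (le_top : (2 : ℕ∞) ≤ ⊤)

section Line

variable {F : Type*} [NormedAddCommGroup F] [NormedSpace ℝ F] {y : E}

theorem hasDerivAt_line {f : E → F} {f' : E →L[ℝ] F} (hf : HasFDerivAt f f' y) (u : E) :
    HasDerivAt (fun t : ℝ ↦ f (y + t • u)) (f' u) 0 := by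
  have h : HasDerivAt (fun t : ℝ ↦ y + t • u) u 0 := by
    simpa using ((hasDerivAt_id (0 : ℝ)).smul_const u).const_add y
  exact HasFDerivAt.comp_hasDerivAt (0 : ℝ) (by simpa using hf) h

theorem hasDerivAt_line_apply₂ {G H : Type*} [NormedAddCommGroup G] [NormedSpace ℝ G]
    [NormedAddCommGroup H] [NormedSpace ℝ H] {f : E → F →L[ℝ] G →L[ℝ] H}
    {f' : E →L[ℝ] F →L[ℝ] G →L[ℝ] H} (hf : HasFDerivAt f f' y) (u : E) (v : F) (w : G) :
    HasDerivAt (fun t : ℝ ↦ f (y + t • u) v w) (f' u v w) 0 := by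
  simpa using ((hasDerivAt_line hf u).clm_apply (hasDerivAt_const (0 : ℝ) v)).clm_apply
    (hasDerivAt_const (0 : ℝ) w)

theorem eventually_line_mem {U : Set E} (hU : IsOpen U) (hy : y ∈ U) (u : E) :
    ∀ᶠ t : ℝ in 𝓝 0, y + t • u ∈ U := by
  have h : Continuous fun t : ℝ ↦ y + t • u := by fun_prop
  exact h.continuousAt.eventually_mem (hU.mem_nhds (by simpa using hy))

end Line

theorem contDiff_christoffelTrilin :
    ContDiff ℝ ∞ (christoffelTrilin : (E →L[ℝ] E →L[ℝ] E →L[ℝ] ℝ) → _) := by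
  have h1 : ContDiff ℝ ∞ fun D : E →L[ℝ] E →L[ℝ] E →L[ℝ] ℝ ↦ D.flip :=
    (ContinuousLinearMap.flipₗᵢ ℝ E E (E →L[ℝ] ℝ)).toContinuousLinearEquiv.contDiff
  exact ((contDiff_id.add h1).sub (contDiff_const.clm_comp h1)).const_smul _

variable {g : E → E →L[ℝ] E →L[ℝ] ℝ} {U : Set E} {y : E}

namespace IsMetricOn

theorem contDiffAt (hg : IsMetricOn g U) (hy : y ∈ U) : ContDiffAt ℝ ∞ g y :=
  hg.contDiffOn.contDiffAt (hg.isOpen.mem_nhds hy)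

theorem differentiableAt (hg : IsMetricOn g U) (hy : y ∈ U) : DifferentiableAt ℝ g y :=
  (hg.contDiffAt hy).differentiableAt (by simp)

theorem contDiffAt_fderiv (hg : IsMetricOn g U) (hy : y ∈ U) :
    ContDiffAt ℝ ∞ (fderiv ℝ g) y :=
  (hg.contDiffAt hy).fderiv_right (m := ∞) (by simp)

theorem contDiffAt_christoffelCLM [CompleteSpace E] (hg : IsMetricOn g U) (hy : y ∈ U) :
    ContDiffAt ℝ ∞ (christoffelCLM g) y := by
  have h1 : ContDiffAt ℝ ∞ (fun z ↦ (g z).inverse) y :=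
    (hg.isInvertible y hy).contDiffAt_map_inverse.comp y (hg.contDiffAt hy)
  have h2 : ContDiffAt ℝ ∞ (fun z ↦ christoffelTrilin (fderiv ℝ g z)) y :=
    contDiff_christoffelTrilin.contDiffAt.comp y (hg.contDiffAt_fderiv hy)
  exact ((ContinuousLinearMap.compL ℝ E (E →L[ℝ] ℝ) E).contDiff.contDiffAt.comp y h1).clm_comp h2

theorem fderiv_symm (hg : IsMetricOn g U) (hy : y ∈ U) (u v w : E) :
    fderiv ℝ g y u v w = fderiv ℝ g y u w v := by
  have h1 (v w : E) : HasDerivAt (fun t : ℝ ↦ g (y + t • u) v w) (fderiv ℝ g y u v w) 0 :=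
    hasDerivAt_line_apply₂ (hg.differentiableAt hy).hasFDerivAt u v w
  have h3 : (fun t : ℝ ↦ g (y + t • u) v w) =ᶠ[𝓝 0] fun t ↦ g (y + t • u) w v := by
    filter_upwards [eventually_line_mem hg.isOpen hy u] with t ht using hg.symm _ ht _ _
  exact (h1 v w).unique ((h1 w v).congr_of_eventuallyEq h3)

theorem apply_christoffel (hg : IsMetricOn g U) (hy : y ∈ U) (u v w : E) :
    g y (christoffel g y u v) w =
      (fderiv ℝ g y u v w + fderiv ℝ g y v u w - fderiv ℝ g y w u v) / 2 := by
  have h : g y (christoffel g y u v) = christoffelForm g y u v := by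
    obtain ⟨e, he⟩ := hg.isInvertible y hy
    simp [christoffel, ← he]
  rw [h]
  simp [christoffelForm]
  ring

theorem christoffel_symm (hg : IsMetricOn g U) (hy : y ∈ U) (u v : E) :
    christoffel g y u v = christoffel g y v u := by
  unfold christoffel
  congr 1
  ext w
  simp [christoffelForm, hg.fderiv_symm hy w u v]
  ring

theorem christoffelCLM_symm (hg : IsMetricOn g U) (hy : y ∈ U) (u v : E) :
    christoffelCLM g y u v = christoffelCLM g y v u := hg.christoffel_symm hy u v

/-- The Levi-Civita connection is compatible with the metric. -/
theorem fderiv_eq (hg : IsMetricOn g U) (hy : y ∈ U) (u a b : E) :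
    fderiv ℝ g y u a b = g y (christoffelCLM g y u a) b + g y a (christoffelCLM g y u b) := by
  simp only [christoffelCLM_apply]
  rw [hg.symm y hy a, hg.apply_christoffel hy, hg.apply_christoffel hy, hg.fderiv_symm hy u b a,
    hg.fderiv_symm hy a u b, hg.fderiv_symm hy b u a]
  ring

theorem hasFDerivAt_christoffelCLM [CompleteSpace E] (hg : IsMetricOn g U) (hy : y ∈ U) :
    HasFDerivAt (christoffelCLM g) (fderiv ℝ (christoffelCLM g) y) y :=
  ((hg.contDiffAt_christoffelCLM hy).differentiableAt (by simp)).hasFDerivAt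

theorem curvature_eq [CompleteSpace E] (hg : IsMetricOn g U) (hy : y ∈ U) (u v w : E) :
    curvature g y u v w =
      fderiv ℝ (christoffelCLM g) y u v w - fderiv ℝ (christoffelCLM g) y v u w
        + christoffelCLM g y u (christoffelCLM g y v w)
        - christoffelCLM g y v (christoffelCLM g y u w) := by
  have h (a b c : E) : fderiv ℝ (fun z ↦ christoffel g z a b) y c =
      fderiv ℝ (christoffelCLM g) y c a b := by
    have h0 := hg.hasFDerivAt_christoffelCLM hy
    have h1 : DifferentiableAt ℝ (fun z ↦ christoffelCLM g z a b) y :=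
      (h0.differentiableAt.clm_apply (differentiableAt_const a)).clm_apply
        (differentiableAt_const b)
    exact (hasDerivAt_line h1.hasFDerivAt c).unique (hasDerivAt_line_apply₂ h0 c a b)
  simp only [curvature, h, christoffelCLM_apply]

theorem christoffelCLM_fderiv_symm [CompleteSpace E] (hg : IsMetricOn g U) (hy : y ∈ U)
    (u v w : E) :
    fderiv ℝ (christoffelCLM g) y u v w = fderiv ℝ (christoffelCLM g) y u w v := by
  have h1 (v w : E) := hasDerivAt_line_apply₂ (hg.hasFDerivAt_christoffelCLM hy) u v w
  have h3 : (fun t : ℝ ↦ christoffelCLM g (y + t • u) v w) =ᶠ[𝓝 0]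
      fun t ↦ christoffelCLM g (y + t • u) w v := by
    filter_upwards [eventually_line_mem hg.isOpen hy u] with t ht
      using hg.christoffelCLM_symm ht _ _
  exact (h1 v w).unique ((h1 w v).congr_of_eventuallyEq h3)

/-- The derivative of the metric compatibility. -/
theorem fderiv_fderiv_eq [CompleteSpace E] (hg : IsMetricOn g U) (hy : y ∈ U) (u v a b : E) :
    fderiv ℝ (fderiv ℝ g) y u v a b =
      fderiv ℝ g y u (christoffelCLM g y v a) b + g y (fderiv ℝ (christoffelCLM g) y u v a) b
      + (fderiv ℝ g y u a (christoffelCLM g y v b)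
        + g y a (fderiv ℝ (christoffelCLM g) y u v b)) := by
  have hG (c : E) := hasDerivAt_line_apply₂ (hg.hasFDerivAt_christoffelCLM hy) u v c
  have hD : HasDerivAt (fun t : ℝ ↦ g (y + t • u)) (fderiv ℝ g y u) 0 :=
    hasDerivAt_line (hg.differentiableAt hy).hasFDerivAt u
  have hDD : HasFDerivAt (fderiv ℝ g) (fderiv ℝ (fderiv ℝ g) y) y :=
    ((hg.contDiffAt_fderiv hy).differentiableAt (by simp)).hasFDerivAt
  have h0 : HasDerivAt (fun t : ℝ ↦ fderiv ℝ g (y + t • u) v a b)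
      (fderiv ℝ (fderiv ℝ g) y u v a b) 0 := by
    simpa using (hasDerivAt_line_apply₂ hDD u v a).clm_apply (hasDerivAt_const (0 : ℝ) b)
  have h1 := ((hD.clm_apply (hG a)).clm_apply (hasDerivAt_const (0 : ℝ) b)).add
    ((hD.clm_apply (hasDerivAt_const (0 : ℝ) a)).clm_apply (hG b))
  have h3 : (fun t : ℝ ↦ fderiv ℝ g (y + t • u) v a b) =ᶠ[𝓝 0] fun t ↦
      g (y + t • u) (christoffelCLM g (y + t • u) v a) b
        + g (y + t • u) a (christoffelCLM g (y + t • u) v b) := by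
    filter_upwards [eventually_line_mem hg.isOpen hy u] with t ht using hg.fderiv_eq ht _ _ _
  have h := h0.unique (h1.congr_of_eventuallyEq h3)
  simpa only [zero_smul, add_zero, map_zero, add_apply, zero_add] using h

theorem fderiv_fderiv_symm (hg : IsMetricOn g U) (hy : y ∈ U) (u v : E) :
    fderiv ℝ (fderiv ℝ g) y u v = fderiv ℝ (fderiv ℝ g) y v u :=
  ((hg.contDiffAt hy).isSymmSndFDerivAt (by simpa using two_le_infty)).eq u v

/-- The curvature operator is skew-symmetric. -/
theorem curvature_skew [CompleteSpace E] (hg : IsMetricOn g U) (hy : y ∈ U) (u v a b : E) :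
    g y (curvature g y u v a) b = - g y (curvature g y u v b) a := by
  have h := congrArg (fun A ↦ A a b) (hg.fderiv_fderiv_symm hy u v)
  simp only [hg.fderiv_fderiv_eq hy] at h
  simp only [hg.fderiv_eq hy] at h
  simp only [hg.curvature_eq hy, map_add, map_sub, add_apply,
    sub_apply]
  have s (p q : E) := hg.symm y hy p q
  rw [s (fderiv ℝ (christoffelCLM g) y u v b), s (fderiv ℝ (christoffelCLM g) y v u b),
    s (christoffelCLM g y u (christoffelCLM g y v b)),
    s (christoffelCLM g y v (christoffelCLM g y u b))]
  linarith

/-- The biquadratic form `⟨R(u, v)v, u⟩` scales by the squared determinant under a change of basis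
of the plane. -/
theorem curvature_basis_change [CompleteSpace E] (hg : IsMetricOn g U) (hy : y ∈ U) (u v : E)
    (a b c d : ℝ) :
    g y (curvature g y (a • u + b • v) (c • u + d • v) (c • u + d • v)) (a • u + b • v) =
      (a * d - b * c) ^ 2 * g y (curvature g y u v v) u := by
  have h1 (w : E) : curvature g y (a • u + b • v) (c • u + d • v) w =
      (a * d - b * c) • curvature g y u v w := by
    simp only [hg.curvature_eq hy, map_add, map_smul, add_apply,
      smul_apply]
    module
  have h2 : curvature g y u v (c • u + d • v) =
      c • curvature g y u v u + d • curvature g y u v v := by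
    simp only [hg.curvature_eq hy, map_add, map_smul]
    module
  have k1 := hg.curvature_skew hy u v u u
  have k2 := hg.curvature_skew hy u v v v
  have k3 := hg.curvature_skew hy u v u v
  rw [h1, h2]
  simp only [map_add, map_smul, add_apply,
      smul_apply, smul_eq_mul]
  rw [k3, show g y (curvature g y u v u) u = 0 by linarith,
    show g y (curvature g y u v v) v = 0 by linarith]
  ring

end IsMetricOn

end Coordinates

section NormalCoordinates

variable {E : Type*} [NormedAddCommGroup E] [NormedSpace ℝ E]
  {V : Type*} [NormedAddCommGroup V] [NormedSpace ℝ V]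

theorem hasDerivAt_comp_smul {f : V → E} {f' : V →L[ℝ] E} {v : V} {t : ℝ}
    (hf : HasFDerivAt f f' (t • v)) : HasDerivAt (fun s : ℝ ↦ f (s • v)) (f' v) t := by
  have h : HasDerivAt (fun s : ℝ ↦ s • v) v t := by
    simpa using (hasDerivAt_id t).smul_const v
  exact hf.comp_hasDerivAt t h

theorem eventually_smul_mem {W : Set V} (hW : W ∈ 𝓝 0) (v : V) : ∀ᶠ t : ℝ in 𝓝 0, t • v ∈ W := by
  have h : Continuous fun t : ℝ ↦ t • v := by fun_prop
  exact h.continuousAt.eventually_mem (by simpa using hW)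

/-- Taylor expansion of order two at the origin. -/
theorem taylor_two {F : V → E} {W : Set V} (hW : IsOpen W) (h0 : 0 ∈ W)
    (hF : ContDiffOn ℝ ∞ F W) {ε : ℝ} (hε : 0 < ε) :
    ∃ ρ > 0, ∀ v : V, ‖v‖ < ρ →
      ‖F v - F 0 - fderiv ℝ F 0 v - (1 / 2 : ℝ) • fderiv ℝ (fderiv ℝ F) 0 v v‖ ≤ ε * ‖v‖ ^ 2 := by
  have hF' : ContDiffAt ℝ ∞ (fderiv ℝ F) 0 :=
    (hF.contDiffAt (hW.mem_nhds h0)).fderiv_right (m := ∞) (by simp)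
  have hD : HasFDerivAt (fderiv ℝ F) (fderiv ℝ (fderiv ℝ F) 0) 0 :=
    (hF'.differentiableAt (by simp)).hasFDerivAt
  have h1 := (hasFDerivAt_iff_isLittleO_nhds_zero.1 hD).def hε
  obtain ⟨ρ, hρ, hball⟩ := Metric.eventually_nhds_iff_ball.1 (h1.and (hW.mem_nhds h0))
  refine ⟨ρ, hρ, fun v hv ↦ ?_⟩
  have hmem (t : ℝ) (ht : t ∈ Icc (0 : ℝ) 1) : t • v ∈ Metric.ball (0 : V) ρ := by
    rw [mem_ball_zero_iff, norm_smul, Real.norm_of_nonneg ht.1]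
    nlinarith [norm_nonneg v, ht.2]
  have hd (t : ℝ) (ht : t ∈ Icc (0 : ℝ) 1) :
      HasDerivAt (fun s : ℝ ↦ F (s • v) - s • fderiv ℝ F 0 v
          - (s ^ 2 / 2) • fderiv ℝ (fderiv ℝ F) 0 v v)
        (fderiv ℝ F (t • v) v - fderiv ℝ F 0 v - t • fderiv ℝ (fderiv ℝ F) 0 v v) t := by
    have hm := (hball _ (hmem t ht)).2
    have a1 := hasDerivAt_comp_smul (v := v) (t := t)
      ((hF.contDiffAt (hW.mem_nhds hm)).differentiableAt (by simp)).hasFDerivAt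
    have a2 := (hasDerivAt_id t).smul_const (fderiv ℝ F 0 v)
    have a3 := (((hasDerivAt_id t).pow 2).div_const 2).smul_const
      (fderiv ℝ (fderiv ℝ F) 0 v v)
    have a4 : HasDerivAt (fun s : ℝ ↦ F (s • v) - s • fderiv ℝ F 0 v
          - (s ^ 2 / 2) • fderiv ℝ (fderiv ℝ F) 0 v v) _ t := (a1.sub a2).sub a3
    refine a4.congr_deriv ?_
    simp
  have hb (t : ℝ) (ht : t ∈ Ico (0 : ℝ) 1) :
      ‖fderiv ℝ F (t • v) v - fderiv ℝ F 0 v - t • fderiv ℝ (fderiv ℝ F) 0 v v‖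
        ≤ ε * ‖v‖ ^ 2 := by
    have ht' : t ∈ Icc (0 : ℝ) 1 := ⟨ht.1, ht.2.le⟩
    have b1 := (hball _ (hmem t ht')).1
    rw [zero_add] at b1
    have b2 := ContinuousLinearMap.le_of_opNorm_le _ b1 v
    have b3 : ‖t • v‖ ≤ ‖v‖ := by
      rw [norm_smul, Real.norm_of_nonneg ht.1]
      nlinarith [norm_nonneg v, ht.2]
    calc _ ≤ ε * ‖t • v‖ * ‖v‖ := by simpa using b2
      _ ≤ ε * ‖v‖ * ‖v‖ := by gcongr
      _ = _ := by ring
  have := norm_image_sub_le_of_norm_deriv_le_segment_01' (fun t ht ↦ (hd t ht).hasDerivWithinAt) hb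
  refine le_trans (le_of_eq ?_) this
  congr 1
  simp
  abel

/-- The map `f` sends the straight lines through the origin to geodesics. -/
structure IsExpLike (g : E → E →L[ℝ] E →L[ℝ] ℝ) (U : Set E) (f : V → E) (W : Set V) : Prop where
  metric : IsMetricOn g U
  isOpen : IsOpen W
  zero_mem : 0 ∈ W
  contDiffOn : ContDiffOn ℝ ∞ f W
  mapsTo : MapsTo f W U
  geodesic : ∀ v ∈ W, fderiv ℝ (fderiv ℝ f) v v v
    + christoffelCLM g (f v) (fderiv ℝ f v v) (fderiv ℝ f v v) = 0

namespace IsExpLike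

variable {g : E → E →L[ℝ] E →L[ℝ] ℝ} {U : Set E} {f : V → E} {W : Set V} {v : V}

theorem contDiffAt (h : IsExpLike g U f W) (hv : v ∈ W) : ContDiffAt ℝ ∞ f v :=
  h.contDiffOn.contDiffAt (h.isOpen.mem_nhds hv)

theorem hasFDerivAt (h : IsExpLike g U f W) (hv : v ∈ W) : HasFDerivAt f (fderiv ℝ f v) v :=
  ((h.contDiffAt hv).differentiableAt (by simp)).hasFDerivAt

theorem contDiffAt_fderiv (h : IsExpLike g U f W) (hv : v ∈ W) : ContDiffAt ℝ ∞ (fderiv ℝ f) v :=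
  (h.contDiffAt hv).fderiv_right (m := ∞) (by simp)

theorem hasFDerivAt_fderiv (h : IsExpLike g U f W) (hv : v ∈ W) :
    HasFDerivAt (fderiv ℝ f) (fderiv ℝ (fderiv ℝ f) v) v :=
  ((h.contDiffAt_fderiv hv).differentiableAt (by simp)).hasFDerivAt

theorem hasFDerivAt_fderiv_fderiv (h : IsExpLike g U f W) (hv : v ∈ W) :
    HasFDerivAt (fderiv ℝ (fderiv ℝ f)) (fderiv ℝ (fderiv ℝ (fderiv ℝ f)) v) v :=
  (((h.contDiffAt_fderiv hv).fderiv_right (m := ∞) (by simp)).differentiableAt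
    (by simp)).hasFDerivAt

theorem fderiv_fderiv_symm (h : IsExpLike g U f W) (hv : v ∈ W) (a b : V) :
    fderiv ℝ (fderiv ℝ f) v a b = fderiv ℝ (fderiv ℝ f) v b a :=
  ((h.contDiffAt hv).isSymmSndFDerivAt (by simpa using two_le_infty)).eq a b

theorem fderiv₃_symm_left (h : IsExpLike g U f W) (hv : v ∈ W) (a b c : V) :
    fderiv ℝ (fderiv ℝ (fderiv ℝ f)) v a b c = fderiv ℝ (fderiv ℝ (fderiv ℝ f)) v b a c :=
  congrArg (fun A ↦ A c)
    (((h.contDiffAt_fderiv hv).isSymmSndFDerivAt (by simpa using two_le_infty)).eq a b)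

theorem fderiv₃_symm_right (h : IsExpLike g U f W) (hv : v ∈ W) (a b c : V) :
    fderiv ℝ (fderiv ℝ (fderiv ℝ f)) v a b c = fderiv ℝ (fderiv ℝ (fderiv ℝ f)) v a c b := by
  have h1 (b c : V) := hasDerivAt_line_apply₂ (h.hasFDerivAt_fderiv_fderiv hv) a b c
  have h3 : (fun t : ℝ ↦ fderiv ℝ (fderiv ℝ f) (v + t • a) b c) =ᶠ[𝓝 0]
      fun t ↦ fderiv ℝ (fderiv ℝ f) (v + t • a) c b := by
    filter_upwards [eventually_line_mem h.isOpen hv a] with t ht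
      using h.fderiv_fderiv_symm ht _ _
  exact (h1 b c).unique ((h1 c b).congr_of_eventuallyEq h3)

theorem eventually_smul_mem (h : IsExpLike g U f W) (v : V) : ∀ᶠ t : ℝ in 𝓝 0, t • v ∈ W :=
  RiemannianGeometry.eventually_smul_mem (h.isOpen.mem_nhds h.zero_mem) v

theorem hasDerivAt (h : IsExpLike g U f W) {t : ℝ} (ht : t • v ∈ W) :
    HasDerivAt (fun s : ℝ ↦ f (s • v)) (fderiv ℝ f (t • v) v) t :=
  hasDerivAt_comp_smul (h.hasFDerivAt ht)

theorem hasDerivAt_fderiv (h : IsExpLike g U f W) {t : ℝ} (ht : t • v ∈ W) (w : V) :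
    HasDerivAt (fun s : ℝ ↦ fderiv ℝ f (s • v) w) (fderiv ℝ (fderiv ℝ f) (t • v) v w) t := by
  simpa using (hasDerivAt_comp_smul (h.hasFDerivAt_fderiv ht)).clm_apply (hasDerivAt_const t w)

/-- The pullback of the metric `g` under `f`. -/
def pullback (g : E → E →L[ℝ] E →L[ℝ] ℝ) (f : V → E) (v : V) : V →L[ℝ] V →L[ℝ] ℝ :=
  (ContinuousLinearMap.precomp ℝ (fderiv ℝ f v)) ∘L g (f v) ∘L fderiv ℝ f v

theorem pullback_apply (v a b : V) :
    pullback g f v a b = g (f v) (fderiv ℝ f v a) (fderiv ℝ f v b) := rfl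

theorem contDiffOn_pullback (h : IsExpLike g U f W) : ContDiffOn ℝ ∞ (pullback g f) W := by
  intro v hv
  refine ContDiffAt.contDiffWithinAt ?_
  have h1 := h.contDiffAt_fderiv hv
  have h2 : ContDiffAt ℝ ∞ (fun z ↦ g (f z)) v :=
    (h.metric.contDiffAt (h.mapsTo hv)).comp v (h.contDiffAt hv)
  have h3 : ContDiffAt ℝ ∞ (fun z ↦ ContinuousLinearMap.precomp ℝ (F := E) (fderiv ℝ f z)) v :=
    ((ContinuousLinearMap.compL ℝ V E ℝ).flip.contDiff.contDiffAt.comp v h1)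
  exact h3.clm_comp (h2.clm_comp h1)

theorem hasDerivAt_pullback (h : IsExpLike g U f W) {t : ℝ} (ht : t • v ∈ W) (w : V) :
    HasDerivAt (fun s : ℝ ↦ pullback g f (s • v) w w)
      (2 * g (f (t • v)) (fderiv ℝ (fderiv ℝ f) (t • v) v w
        + christoffelCLM g (f (t • v)) (fderiv ℝ f (t • v) v) (fderiv ℝ f (t • v) w))
        (fderiv ℝ f (t • v) w)) t := by
  have hy := h.mapsTo ht
  have h1 : HasDerivAt (fun s : ℝ ↦ g (f (s • v)))
      (fderiv ℝ g (f (t • v)) (fderiv ℝ f (t • v) v)) t :=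
    (h.metric.differentiableAt hy).hasFDerivAt.comp_hasDerivAt t (h.hasDerivAt ht)
  have h2 := h.hasDerivAt_fderiv ht w
  refine ((h1.clm_apply h2).clm_apply h2).congr_deriv ?_
  rw [add_apply, h.metric.fderiv_eq hy,
    h.metric.symm _ hy (fderiv ℝ f (t • v) w),
    h.metric.symm _ hy (fderiv ℝ f (t • v) w)]
  simp only [map_add, add_apply]
  ring

variable [CompleteSpace E]

/-- The derivative of the covariant derivative of `t ↦ df_{tv}(w)` along `t ↦ f(tv)`. -/
theorem hasDerivAt_covDeriv (h : IsExpLike g U f W) {t : ℝ} (ht : t • v ∈ W) (w : V) :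
    HasDerivAt (fun s : ℝ ↦ fderiv ℝ (fderiv ℝ f) (s • v) v w
        + christoffelCLM g (f (s • v)) (fderiv ℝ f (s • v) v) (fderiv ℝ f (s • v) w))
      (fderiv ℝ (fderiv ℝ (fderiv ℝ f)) (t • v) v v w
        + ((fderiv ℝ (christoffelCLM g) (f (t • v)) (fderiv ℝ f (t • v) v) (fderiv ℝ f (t • v) v)
              + christoffelCLM g (f (t • v)) (fderiv ℝ (fderiv ℝ f) (t • v) v v))
            (fderiv ℝ f (t • v) w)
          + christoffelCLM g (f (t • v)) (fderiv ℝ f (t • v) v)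
              (fderiv ℝ (fderiv ℝ f) (t • v) v w))) t := by
  have h1 : HasDerivAt (fun s : ℝ ↦ fderiv ℝ (fderiv ℝ f) (s • v) v w)
      (fderiv ℝ (fderiv ℝ (fderiv ℝ f)) (t • v) v v w) t := by
    simpa using ((hasDerivAt_comp_smul (h.hasFDerivAt_fderiv_fderiv ht)).clm_apply
      (hasDerivAt_const t v)).clm_apply (hasDerivAt_const t w)
  have h2 : HasDerivAt (fun s : ℝ ↦ christoffelCLM g (f (s • v)))
      (fderiv ℝ (christoffelCLM g) (f (t • v)) (fderiv ℝ f (t • v) v)) t :=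
    HasFDerivAt.comp_hasDerivAt (l := christoffelCLM g) (f := fun s : ℝ ↦ f (s • v)) t
      (h.metric.hasFDerivAt_christoffelCLM (h.mapsTo ht)) (h.hasDerivAt ht)
  exact h1.add ((h2.clm_apply (h.hasDerivAt_fderiv ht v)).clm_apply (h.hasDerivAt_fderiv ht w))

/-- The lines `t ↦ f(tv)` satisfy the geodesic equation. -/
theorem eventually_geodesic (h : IsExpLike g U f W) (v : V) :
    ∀ᶠ t : ℝ in 𝓝 0, fderiv ℝ (fderiv ℝ f) (t • v) v v
      + christoffelCLM g (f (t • v)) (fderiv ℝ f (t • v) v) (fderiv ℝ f (t • v) v) = 0 := by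
  have h1 : ∀ t : ℝ, t • v ∈ W → t ≠ 0 → fderiv ℝ (fderiv ℝ f) (t • v) v v
      + christoffelCLM g (f (t • v)) (fderiv ℝ f (t • v) v) (fderiv ℝ f (t • v) v) = 0 := by
    intro t ht h0
    have h2 := h.geodesic _ ht
    simp only [map_smul, smul_apply, ← smul_add, smul_eq_zero, h0, false_or] at h2
    exact h2
  have h0 : fderiv ℝ (fderiv ℝ f) ((0 : ℝ) • v) v v
      + christoffelCLM g (f ((0 : ℝ) • v)) (fderiv ℝ f ((0 : ℝ) • v) v)
        (fderiv ℝ f ((0 : ℝ) • v) v) = 0 := by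
    have hc := (h.hasDerivAt_covDeriv (v := v) (t := 0) (by simpa using h.zero_mem) v).continuousAt
    refine tendsto_nhds_unique
      (hc.tendsto.mono_left (nhdsWithin_le_nhds (s := {(0 : ℝ)}ᶜ))) ?_
    refine tendsto_const_nhds.congr' ?_
    filter_upwards [(h.eventually_smul_mem v).filter_mono nhdsWithin_le_nhds,
      self_mem_nhdsWithin] with t ht ht'
    exact (h1 t ht ht').symm
  filter_upwards [h.eventually_smul_mem v] with t ht
  by_cases ht0 : t = 0
  · rw [ht0]; exact h0
  · exact h1 t ht ht0

theorem fderiv_fderiv_self (h : IsExpLike g U f W) (v : V) :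
    fderiv ℝ (fderiv ℝ f) 0 v v
      + christoffelCLM g (f 0) (fderiv ℝ f 0 v) (fderiv ℝ f 0 v) = 0 := by
  simpa using (h.eventually_geodesic v).self_of_nhds

theorem fderiv_fderiv_eq (h : IsExpLike g U f W) (v w : V) :
    fderiv ℝ (fderiv ℝ f) 0 v w
      = - christoffelCLM g (f 0) (fderiv ℝ f 0 v) (fderiv ℝ f 0 w) := by
  have h1 := h.fderiv_fderiv_self (v + w)
  have h2 := h.fderiv_fderiv_self v
  have h3 := h.fderiv_fderiv_self w
  simp only [map_add, add_apply] at h1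
  rw [h.fderiv_fderiv_symm h.zero_mem w v,
    h.metric.christoffelCLM_symm (h.mapsTo h.zero_mem) (fderiv ℝ f 0 w)] at h1
  linear_combination (norm := module) (1 / 2 : ℝ) • (h1 - h2 - h3)

theorem fderiv₃_self (h : IsExpLike g U f W) (v : V) :
    fderiv ℝ (fderiv ℝ (fderiv ℝ f)) 0 v v v
        + fderiv ℝ (christoffelCLM g) (f 0) (fderiv ℝ f 0 v) (fderiv ℝ f 0 v) (fderiv ℝ f 0 v)
        - (2 : ℝ) • christoffelCLM g (f 0)
          (christoffelCLM g (f 0) (fderiv ℝ f 0 v) (fderiv ℝ f 0 v)) (fderiv ℝ f 0 v) = 0 := by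
  have h1 := h.hasDerivAt_covDeriv (v := v) (t := 0) (by simpa using h.zero_mem) v
  have h2 := h1.unique ((hasDerivAt_const (0 : ℝ) (0 : E)).congr_of_eventuallyEq
    (h.eventually_geodesic v))
  simp only [zero_smul, h.fderiv_fderiv_eq, map_neg, neg_apply, add_apply] at h2
  rw [h.metric.christoffelCLM_symm (h.mapsTo h.zero_mem) (fderiv ℝ f 0 v) (christoffelCLM _ _ _ _)]
    at h2
  rw [← h2]
  module

theorem fderiv₃_eq (h : IsExpLike g U f W) (v w : V) :
    (3 : ℝ) • fderiv ℝ (fderiv ℝ (fderiv ℝ f)) 0 v v w =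
      - fderiv ℝ (christoffelCLM g) (f 0) (fderiv ℝ f 0 w) (fderiv ℝ f 0 v) (fderiv ℝ f 0 v)
      - (2 : ℝ) • fderiv ℝ (christoffelCLM g) (f 0) (fderiv ℝ f 0 v) (fderiv ℝ f 0 v)
          (fderiv ℝ f 0 w)
      + (2 : ℝ) • christoffelCLM g (f 0) (fderiv ℝ f 0 w)
          (christoffelCLM g (f 0) (fderiv ℝ f 0 v) (fderiv ℝ f 0 v))
      + (4 : ℝ) • christoffelCLM g (f 0) (fderiv ℝ f 0 v)
          (christoffelCLM g (f 0) (fderiv ℝ f 0 v) (fderiv ℝ f 0 w)) := by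
  have hy := h.mapsTo h.zero_mem
  have h1 := h.fderiv₃_self (v + w)
  have h2 := h.fderiv₃_self (v - w)
  have h3 := h.fderiv₃_self w
  simp only [map_add, map_sub, add_apply, sub_apply] at h1 h2
  have e1 := h.fderiv₃_symm_right h.zero_mem v w v
  have e2 := h.fderiv₃_symm_left h.zero_mem w v v
  have e3 := h.metric.christoffelCLM_fderiv_symm hy (fderiv ℝ f 0 v) (fderiv ℝ f 0 w)
    (fderiv ℝ f 0 v)
  have e4 := h.metric.christoffelCLM_symm hy (fderiv ℝ f 0 w) (fderiv ℝ f 0 v)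
  have e5 := h.metric.christoffelCLM_symm hy (fderiv ℝ f 0 w)
    (christoffelCLM g (f 0) (fderiv ℝ f 0 v) (fderiv ℝ f 0 v))
  have e6 := h.metric.christoffelCLM_symm hy (fderiv ℝ f 0 v)
    (christoffelCLM g (f 0) (fderiv ℝ f 0 v) (fderiv ℝ f 0 w))
  rw [e5, e6]
  rw [e1, e2, e1, e3, e4] at h1 h2
  linear_combination (norm := module) (1 / 2 : ℝ) • h1 - (1 / 2 : ℝ) • h2 - h3

/-- The second covariant derivative of `t ↦ df_{tv}(w)` at the origin. -/
theorem covDeriv_covDeriv_eq (h : IsExpLike g U f W) (v w : V) :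
    HasDerivAt (fun s : ℝ ↦ fderiv ℝ (fderiv ℝ f) (s • v) v w
        + christoffelCLM g (f (s • v)) (fderiv ℝ f (s • v) v) (fderiv ℝ f (s • v) w))
      (-(1 / 3 : ℝ) • curvature g (f 0) (fderiv ℝ f 0 w) (fderiv ℝ f 0 v) (fderiv ℝ f 0 v)) 0 := by
  have hy := h.mapsTo h.zero_mem
  convert h.hasDerivAt_covDeriv (v := v) (t := 0) (by simpa using h.zero_mem) w using 1
  have h1 := h.fderiv₃_eq v w
  rw [h.metric.curvature_eq hy]
  simp only [zero_smul, h.fderiv_fderiv_eq, map_neg, neg_apply, add_apply]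
  rw [h.metric.christoffelCLM_fderiv_symm hy (fderiv ℝ f 0 v) (fderiv ℝ f 0 w)
    (fderiv ℝ f 0 v), h.metric.christoffelCLM_symm hy (christoffelCLM g (f 0) _ _),
    h.metric.christoffelCLM_symm hy (fderiv ℝ f 0 w) (fderiv ℝ f 0 v)]
  linear_combination (norm := module) -(1 / 3 : ℝ) • h1

theorem fderiv_pullback_eq_zero (h : IsExpLike g U f W) (v w : V) :
    fderiv ℝ (pullback g f) 0 v w w = 0 := by
  have h0 : HasFDerivAt (pullback g f) (fderiv ℝ (pullback g f) 0) ((0 : ℝ) • v) := by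
    rw [zero_smul]
    exact ((h.contDiffOn_pullback.contDiffAt (h.isOpen.mem_nhds h.zero_mem)).differentiableAt
      (by simp)).hasFDerivAt
  have h1 := ((hasDerivAt_comp_smul h0).clm_apply (hasDerivAt_const (0 : ℝ) w)).clm_apply
    (hasDerivAt_const (0 : ℝ) w)
  have h2 := h.hasDerivAt_pullback (v := v) (t := 0) (by simpa using h.zero_mem) w
  have h3 := h1.unique h2
  simpa [h.fderiv_fderiv_eq] using h3

theorem fderiv_fderiv_pullback (h : IsExpLike g U f W) (v w : V) :
    fderiv ℝ (fderiv ℝ (pullback g f)) 0 v v w w =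
      -(2 / 3) * g (f 0) (curvature g (f 0) (fderiv ℝ f 0 w) (fderiv ℝ f 0 v) (fderiv ℝ f 0 v))
        (fderiv ℝ f 0 w) := by
  have h0 (z : V) (hz : z ∈ W) : HasFDerivAt (pullback g f) (fderiv ℝ (pullback g f) z) z :=
    ((h.contDiffOn_pullback.contDiffAt (h.isOpen.mem_nhds hz)).differentiableAt
      (by simp)).hasFDerivAt
  have h0' : HasFDerivAt (fderiv ℝ (pullback g f)) (fderiv ℝ (fderiv ℝ (pullback g f)) 0)
      ((0 : ℝ) • v) := by
    rw [zero_smul]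
    exact (((h.contDiffOn_pullback.contDiffAt (h.isOpen.mem_nhds h.zero_mem)).fderiv_right
      (m := ∞) (by simp)).differentiableAt (by simp)).hasFDerivAt
  have h1 : HasDerivAt (fun t : ℝ ↦ fderiv ℝ (pullback g f) (t • v) v w w)
      (fderiv ℝ (fderiv ℝ (pullback g f)) 0 v v w w) 0 := by
    simpa using (((hasDerivAt_comp_smul h0').clm_apply (hasDerivAt_const (0 : ℝ) v)).clm_apply
      (hasDerivAt_const (0 : ℝ) w)).clm_apply (hasDerivAt_const (0 : ℝ) w)
  have h2 : (fun t : ℝ ↦ fderiv ℝ (pullback g f) (t • v) v w w) =ᶠ[𝓝 0]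
      fun t : ℝ ↦ 2 * g (f (t • v)) (fderiv ℝ (fderiv ℝ f) (t • v) v w
        + christoffelCLM g (f (t • v)) (fderiv ℝ f (t • v) v) (fderiv ℝ f (t • v) w))
        (fderiv ℝ f (t • v) w) := by
    filter_upwards [h.eventually_smul_mem v] with t ht
    have h3 := ((hasDerivAt_comp_smul (h0 _ ht)).clm_apply (hasDerivAt_const t w)).clm_apply
      (hasDerivAt_const t w)
    simpa using h3.unique (h.hasDerivAt_pullback ht w)
  have hz : (0 : ℝ) • v ∈ W := by simpa using h.zero_mem
  have h4 : HasDerivAt (fun s : ℝ ↦ g (f (s • v)))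
      (fderiv ℝ g (f ((0 : ℝ) • v)) (fderiv ℝ f ((0 : ℝ) • v) v)) 0 :=
    (h.metric.differentiableAt (h.mapsTo hz)).hasFDerivAt.comp_hasDerivAt 0 (h.hasDerivAt hz)
  have h5 := ((h4.clm_apply (h.covDeriv_covDeriv_eq v w)).clm_apply
    (h.hasDerivAt_fderiv hz w)).const_mul 2
  rw [h1.unique (h5.congr_of_eventuallyEq h2)]
  simp [h.fderiv_fderiv_eq]
  ring

/-- The Taylor expansion of the metric in normal coordinates. -/
theorem pullback_expansion (h : IsExpLike g U f W) {ε : ℝ} (hε : 0 < ε) :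
    ∃ ρ > 0, ∀ v : V, ‖v‖ < ρ → ∀ w : V,
      |g (f v) (fderiv ℝ f v w) (fderiv ℝ f v w) - g (f 0) (fderiv ℝ f 0 w) (fderiv ℝ f 0 w)
        + 1 / 3 * g (f 0) (curvature g (f 0) (fderiv ℝ f 0 w) (fderiv ℝ f 0 v) (fderiv ℝ f 0 v))
        (fderiv ℝ f 0 w)| ≤ ε * ‖v‖ ^ 2 * ‖w‖ ^ 2 := by
  obtain ⟨ρ, hρ, hb⟩ := taylor_two h.isOpen h.zero_mem h.contDiffOn_pullback hε
  refine ⟨ρ, hρ, fun v hv w ↦ ?_⟩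
  have h1 := ContinuousLinearMap.le_of_opNorm_le _ (hb v hv) w
  have h2 := ContinuousLinearMap.le_of_opNorm_le _ h1 w
  simp only [sub_apply, smul_apply, h.fderiv_pullback_eq_zero, h.fderiv_fderiv_pullback,
    pullback_apply, Real.norm_eq_abs, smul_eq_mul] at h2
  calc _ = _ := by congr 1; ring
    _ ≤ _ := h2
    _ = _ := by ring

end IsExpLike

end NormalCoordinates

section ChartMetric

variable {E : Type*} [NormedAddCommGroup E] [NormedSpace ℝ E]
  {H : Type*} [TopologicalSpace H] (I : ModelWithCorners ℝ E H)
  {M : Type*} [TopologicalSpace M] [ChartedSpace H M] [IsManifold I ∞ M]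
  {V : Type*} [NormedAddCommGroup V] [NormedSpace ℝ V] {F : V → M} {v : V}

theorem mem_baseSet_of_mem_target {x₀ : M} {y : E} (hy : y ∈ (extChartAt I x₀).target) :
    (extChartAt I x₀).symm y ∈ (trivializationAt E (TangentSpace I : M → Type _) x₀).baseSet := by
  simpa using (extChartAt I x₀).map_target hy

theorem continuousLinearMapAt_mfderiv {x₀ : M} (hF : MDifferentiableAt 𝓘(ℝ, V) I F v)
    (hx : F v ∈ (extChartAt I x₀).source) (w : V) :
    (trivializationAt E (TangentSpace I : M → Type _) x₀).continuousLinearMapAt ℝ (F v)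
      (mfderiv 𝓘(ℝ, V) I F v w) = fderiv ℝ (fun z ↦ extChartAt I x₀ (F z)) v w := by
  rw [extChartAt_source] at hx
  rw [TangentBundle.continuousLinearMapAt_trivializationAt hx]
  have h := mfderiv_comp v (mdifferentiableAt_extChartAt (I := I) hx) hF
  rw [mfderiv_eq_fderiv] at h
  exact (congrArg (fun A ↦ A w) h).symm

variable [RiemannianBundle (fun x : M ↦ TangentSpace I x)]

theorem chartMetric_symm (x₀ : M) (y u v : E) :
    chartMetric I x₀ y u v = chartMetric I x₀ y v u := by
  rw [chartMetric_apply, chartMetric_apply, real_inner_comm]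

theorem chartMetric_self_pos {x₀ : M} {y : E} (hy : y ∈ (extChartAt I x₀).target) {u : E}
    (hu : u ≠ 0) : 0 < chartMetric I x₀ y u u := by
  rw [chartMetric_apply, real_inner_self_pos]
  intro h
  apply hu
  rw [← (trivializationAt E (TangentSpace I : M → Type _) x₀).continuousLinearMapAt_symmL
    (R := ℝ) (mem_baseSet_of_mem_target I hy) u, h, map_zero]

theorem isInvertible_of_injective [FiniteDimensional ℝ E] {A : E →L[ℝ] E →L[ℝ] ℝ}
    (hA : Function.Injective A) : A.IsInvertible := by
  have h : Module.finrank ℝ E = Module.finrank ℝ (E →L[ℝ] ℝ) := by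
    rw [← (LinearMap.toContinuousLinearMap (𝕜 := ℝ) (E := E) (F' := ℝ)).finrank_eq]
    exact (Subspace.dual_finrank_eq (K := ℝ) (V := E)).symm
  let e := LinearEquiv.ofInjectiveOfFinrankEq (A : E →ₗ[ℝ] E →L[ℝ] ℝ) hA h
  exact ⟨e.toContinuousLinearEquiv, by ext; rfl⟩

theorem contDiffOn_chartMetric_apply
    [IsContMDiffRiemannianBundle I ∞ E (fun x : M ↦ TangentSpace I x)] (x₀ : M) (u v : E) :
    ContDiffOn ℝ ∞ (fun y ↦ chartMetric I x₀ y u v) (extChartAt I x₀).target := by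
  have h1 : ContMDiffOn 𝓘(ℝ, E) I ∞ (extChartAt I x₀).symm (extChartAt I x₀).target :=
    contMDiffOn_extChartAt_symm x₀
  have h2 (u : E) : ContMDiffOn 𝓘(ℝ, E) (I.prod 𝓘(ℝ, E)) ∞
      (fun y ↦ (⟨(extChartAt I x₀).symm y,
        (trivializationAt E (TangentSpace I : M → Type _) x₀).symmL ℝ
          ((extChartAt I x₀).symm y) u⟩ : TotalSpace E (TangentSpace I : M → Type _)))
      (extChartAt I x₀).target := by
    have h3 := (trivializationAt E (TangentSpace I : M → Type _) x₀).contMDiffOn_symm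
      (IB := I) (n := ∞)
    refine (h3.comp (h1.prodMk (contMDiffOn_const (c := u))) ?_).congr ?_
    · intro y hy
      rw [mem_preimage, Trivialization.mem_target]
      exact mem_baseSet_of_mem_target I hy
    · intro y hy
      rw [Trivialization.symmL_apply _ (mem_baseSet_of_mem_target I hy)]
      exact Trivialization.mk_symm _ (mem_baseSet_of_mem_target I hy) u
  let σ (u y : E) : TangentSpace I ((extChartAt I x₀).symm y) :=
    (trivializationAt E (TangentSpace I : M → Type _) x₀).symmL ℝ ((extChartAt I x₀).symm y) u
  have h4 := ContMDiffOn.inner_bundle (E := fun x : M ↦ TangentSpace I x)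
    (b := (extChartAt I x₀).symm) (v := σ u) (w := σ v) (h2 u) (h2 v)
  exact h4.contDiffOn

theorem isMetricOn_chartMetric [FiniteDimensional ℝ E] [I.Boundaryless]
    [IsContMDiffRiemannianBundle I ∞ E (fun x : M ↦ TangentSpace I x)] (x₀ : M) :
    IsMetricOn (chartMetric I x₀) (extChartAt I x₀).target where
  isOpen := isOpen_extChartAt_target x₀
  contDiffOn := contDiffOn_clm_apply.2 fun u ↦ contDiffOn_clm_apply.2 fun v ↦
    contDiffOn_chartMetric_apply I x₀ u v
  symm y _ u v := chartMetric_symm I x₀ y u v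
  isInvertible y hy := by
    refine isInvertible_of_injective ((injective_iff_map_eq_zero _).2 fun u hu ↦ ?_)
    by_contra h
    have := chartMetric_self_pos I hy h
    simp [hu] at this

theorem chartMetric_continuousLinearMapAt {x₀ x : M} (hx : x ∈ (extChartAt I x₀).source)
    (ξ ζ : TangentSpace I x) :
    chartMetric I x₀ (extChartAt I x₀ x)
      ((trivializationAt E (TangentSpace I : M → Type _) x₀).continuousLinearMapAt ℝ x ξ)
      ((trivializationAt E (TangentSpace I : M → Type _) x₀).continuousLinearMapAt ℝ x ζ)
      = inner ℝ ξ ζ := by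
  have hb : x ∈ (trivializationAt E (TangentSpace I : M → Type _) x₀).baseSet := by
    simpa using hx
  rw [chartMetric_apply, (extChartAt I x₀).left_inv hx,
    Trivialization.symmL_continuousLinearMapAt _ hb,
    Trivialization.symmL_continuousLinearMapAt _ hb]

theorem chartMetric_coordVector (q : M) (v w : TangentSpace I q) :
    chartMetric I q (extChartAt I q q) (coordVector I q v) (coordVector I q w) = inner ℝ v w :=
  chartMetric_continuousLinearMapAt I (mem_extChartAt_source q) v w

theorem norm_mfderiv_sq {x₀ : M} (hF : MDifferentiableAt 𝓘(ℝ, V) I F v)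
    (hx : F v ∈ (extChartAt I x₀).source) (w : V) :
    ‖mfderiv 𝓘(ℝ, V) I F v w‖ ^ 2 = chartMetric I x₀ (extChartAt I x₀ (F v))
      (fderiv ℝ (fun z ↦ extChartAt I x₀ (F z)) v w)
      (fderiv ℝ (fun z ↦ extChartAt I x₀ (F z)) v w) := by
  rw [← continuousLinearMapAt_mfderiv I hF hx, chartMetric_continuousLinearMapAt I hx,
    real_inner_self_eq_norm_sq]

end ChartMetric

section GeodesicODE

variable {E : Type*} [NormedAddCommGroup E] [NormedSpace ℝ E]
  {g : E → E →L[ℝ] E →L[ℝ] ℝ} {U : Set E}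

theorem contDiffAt_deriv {u : ℝ → E} {t : ℝ} (hu : ContDiffAt ℝ ∞ u t) :
    ContDiffAt ℝ ∞ (deriv u) t := by
  have h : ContDiffAt ℝ ∞ (fun s ↦ fderiv ℝ u s 1) t :=
    (hu.fderiv_right (m := ∞) (by simp)).clm_apply contDiffAt_const
  exact h

theorem hasDerivAt_phase {u : ℝ → E} {t : ℝ} (hu : ContDiffAt ℝ ∞ u t)
    (ho : deriv (deriv u) t + christoffel g (u t) (deriv u t) (deriv u t) = 0) :
    HasDerivAt (fun s ↦ (u s, deriv u s))
      (deriv u t, -christoffelCLM g (u t) (deriv u t) (deriv u t)) t := by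
  have h1 := (hu.differentiableAt (by simp)).hasDerivAt
  have h2 := ((contDiffAt_deriv hu).differentiableAt (by simp)).hasDerivAt
  rw [eq_neg_of_add_eq_zero_left ho] at h2
  exact h1.prodMk h2

/-- Local uniqueness, forward in time, of solutions of the geodesic equation. -/
theorem IsMetricOn.geodesic_unique [CompleteSpace E] (hg : IsMetricOn g U) {u₁ u₂ : ℝ → E}
    {a b : ℝ} (hab : a < b) (h₁ : ∀ t ∈ Ico a b, ContDiffAt ℝ ∞ u₁ t)
    (h₂ : ∀ t ∈ Ico a b, ContDiffAt ℝ ∞ u₂ t)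
    (o₁ : ∀ t ∈ Ico a b, deriv (deriv u₁) t + christoffel g (u₁ t) (deriv u₁ t) (deriv u₁ t) = 0)
    (o₂ : ∀ t ∈ Ico a b, deriv (deriv u₂) t + christoffel g (u₂ t) (deriv u₂ t) (deriv u₂ t) = 0)
    (hU : u₁ a ∈ U) (h0 : u₁ a = u₂ a) (h0' : deriv u₁ a = deriv u₂ a) :
    ∀ᶠ t in 𝓝[>] a, u₁ t = u₂ t := by
  let Φ : E × E → E × E := fun z ↦ (z.2, -christoffelCLM g z.1 z.2 z.2)
  have hΦ : ContDiffAt ℝ 1 Φ (u₁ a, deriv u₁ a) := by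
    have k1 : ContDiffAt ℝ 1 (fun z : E × E ↦ christoffelCLM g z.1) (u₁ a, deriv u₁ a) :=
      ((hg.contDiffAt_christoffelCLM hU).of_le (by simp)).comp (u₁ a, deriv u₁ a) contDiffAt_fst
    exact contDiffAt_snd.prodMk ((k1.clm_apply contDiffAt_snd).clm_apply contDiffAt_snd).neg
  obtain ⟨K, S, hS, hK⟩ := hΦ.exists_lipschitzOnWith
  have ha : a ∈ Ico a b := ⟨le_rfl, hab⟩
  have c₁ (t) (ht : t ∈ Ico a b) := hasDerivAt_phase (h₁ t ht) (o₁ t ht)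
  have c₂ (t) (ht : t ∈ Ico a b) := hasDerivAt_phase (h₂ t ht) (o₂ t ht)
  have e₁ : ∀ᶠ t in 𝓝 a, (u₁ t, deriv u₁ t) ∈ S := (c₁ a ha).continuousAt.eventually_mem hS
  have e₂ : ∀ᶠ t in 𝓝 a, (u₂ t, deriv u₂ t) ∈ S :=
    (c₂ a ha).continuousAt.eventually_mem (by rwa [← h0, ← h0'])
  obtain ⟨ε, hε, hball⟩ := Metric.eventually_nhds_iff.1 (e₁.and (e₂.and (gt_mem_nhds hab)))
  have hsub {t : ℝ} (ht : t ∈ Icc a (a + ε / 2)) : dist t a < ε := by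
    rw [Real.dist_eq, abs_of_nonneg (by linarith [ht.1])]
    linarith [ht.2]
  have hsub' {t : ℝ} (ht : t ∈ Icc a (a + ε / 2)) : t ∈ Ico a b :=
    ⟨ht.1, (hball (hsub ht)).2.2⟩
  have key := ODE_solution_unique_of_mem_Icc_right (v := fun _ ↦ Φ) (s := fun _ ↦ S) (K := K)
    (f := fun s ↦ (u₁ s, deriv u₁ s)) (g := fun s ↦ (u₂ s, deriv u₂ s))
    (a := a) (b := a + ε / 2) (fun _ _ ↦ hK)
    (fun t ht ↦ (c₁ t (hsub' ht)).continuousAt.continuousWithinAt)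
    (fun t ht ↦ (c₁ t (hsub' (Ico_subset_Icc_self ht))).hasDerivWithinAt)
    (fun t ht ↦ (hball (hsub (Ico_subset_Icc_self ht))).1)
    (fun t ht ↦ (c₂ t (hsub' ht)).continuousAt.continuousWithinAt)
    (fun t ht ↦ (c₂ t (hsub' (Ico_subset_Icc_self ht))).hasDerivWithinAt)
    (fun t ht ↦ (hball (hsub (Ico_subset_Icc_self ht))).2.1) (by simp [h0, h0'])
  filter_upwards [Ioc_mem_nhdsGT (show a < a + ε / 2 by linarith)] with t ht
  exact congrArg Prod.fst (key ⟨ht.1.le, ht.2⟩)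

/-- The speed of a solution of the geodesic equation has derivative zero. -/
theorem IsMetricOn.hasDerivAt_speed (hg : IsMetricOn g U) {u : ℝ → E} {t : ℝ}
    (hu : ContDiffAt ℝ ∞ u t) (hU : u t ∈ U)
    (ho : deriv (deriv u) t + christoffel g (u t) (deriv u t) (deriv u t) = 0) :
    HasDerivAt (fun s ↦ g (u s) (deriv u s) (deriv u s)) 0 t := by
  have h1 := (hu.differentiableAt (by simp)).hasDerivAt
  have h2 := ((contDiffAt_deriv hu).differentiableAt (by simp)).hasDerivAt
  have h3 : HasDerivAt (fun s ↦ g (u s)) (fderiv ℝ g (u t) (deriv u t)) t :=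
    (hg.differentiableAt hU).hasFDerivAt.comp_hasDerivAt t h1
  refine ((h3.clm_apply h2).clm_apply h2).congr_deriv ?_
  rw [add_apply, hg.fderiv_eq hU, hg.symm _ hU (deriv u t) (deriv (deriv u) t),
    hg.symm _ hU (deriv u t) (christoffelCLM g _ _ _), eq_neg_of_add_eq_zero_left ho,
    christoffelCLM_apply, map_neg, neg_apply]
  ring

end GeodesicODE

section Geodesic

variable {E : Type*} [NormedAddCommGroup E] [NormedSpace ℝ E]
  {H : Type*} [TopologicalSpace H] {I : ModelWithCorners ℝ E H}
  {M : Type*} [TopologicalSpace M] [ChartedSpace H M] [IsManifold I ∞ M]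

theorem contDiffAt_extChartAt_comp {V : Type*} [NormedAddCommGroup V] [NormedSpace ℝ V]
    {F : V → M} {v : V} (hF : ContMDiffAt 𝓘(ℝ, V) I ∞ F v) {x₀ : M}
    (hx : F v ∈ (extChartAt I x₀).source) :
    ContDiffAt ℝ ∞ (fun z ↦ extChartAt I x₀ (F z)) v := by
  rw [extChartAt_source] at hx
  exact ((contMDiffAt_extChartAt' hx).comp v hF).contDiffAt

theorem coordVector_smul (q : M) (τ : ℝ) (v : TangentSpace I q) :
    coordVector I q (τ • v) = τ • coordVector I q v := by
  simp [coordVector]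

variable [RiemannianBundle (fun x : M ↦ TangentSpace I x)]

namespace IsGeodesic

variable {c c' : ℝ → M}

theorem continuousOn (hc : IsGeodesic I c) : ContinuousOn c (Icc 0 1) :=
  fun t ht ↦ (hc t ht).1.continuousAt.continuousWithinAt

theorem eventually_mem_source (hc : IsGeodesic I c) {t : ℝ} (ht : t ∈ Icc (0 : ℝ) 1) {x₀ : M}
    (hx : c t ∈ (extChartAt I x₀).source) : ∀ᶠ s in 𝓝 t, c s ∈ (extChartAt I x₀).source :=
  (hc t ht).1.continuousAt.eventually_mem ((isOpen_extChartAt_source x₀).mem_nhds hx)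

theorem comp_mul (hc : IsGeodesic I c) {τ : ℝ} (hτ : τ ∈ Icc (0 : ℝ) 1) :
    IsGeodesic I (fun s ↦ c (τ * s)) := by
  intro t ht
  have ht' : τ * t ∈ Icc (0 : ℝ) 1 := ⟨mul_nonneg hτ.1 ht.1, mul_le_one₀ hτ.2 ht.1 ht.2⟩
  refine ⟨(hc _ ht').1.comp t (ContDiffAt.contMDiffAt (by fun_prop)), fun x₀ hx ↦ ?_⟩
  have h := (hc _ ht').2 x₀ hx
  have e : deriv (fun s ↦ extChartAt I x₀ (c (τ * s))) =
      fun s ↦ τ • deriv (fun s ↦ extChartAt I x₀ (c s)) (τ * s) := by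
    ext s
    exact deriv_comp_mul_left τ (fun s ↦ extChartAt I x₀ (c s)) s
  simp only [e]
  rw [deriv_fun_const_smul_field, deriv_comp_mul_left τ (deriv fun s ↦ extChartAt I x₀ (c s))]
  simp only [← christoffelCLM_apply, map_smul, smul_apply, ← smul_add] at h ⊢
  rw [h, smul_zero, smul_zero]

variable [FiniteDimensional ℝ E] [I.Boundaryless]
  [IsContMDiffRiemannianBundle I ∞ E (fun x : M ↦ TangentSpace I x)]

/-- Geodesics have constant speed. -/
theorem norm_mfderiv_eq (hc : IsGeodesic I c) {t : ℝ} (ht : t ∈ Icc (0 : ℝ) 1) :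
    ‖mfderiv 𝓘(ℝ, ℝ) I c t (1 : ℝ)‖ = ‖mfderiv 𝓘(ℝ, ℝ) I c 0 (1 : ℝ)‖ := by
  have hd : ∀ s ∈ Icc (0 : ℝ) 1, HasDerivAt (fun s ↦ ‖mfderiv 𝓘(ℝ, ℝ) I c s (1 : ℝ)‖ ^ 2) 0 s := by
    intro s hs
    have hx := mem_extChartAt_source (I := I) (c s)
    have h1 := (isMetricOn_chartMetric I (c s)).hasDerivAt_speed
      (contDiffAt_extChartAt_comp (hc s hs).1 hx) ((extChartAt I (c s)).map_source hx)
      ((hc s hs).2 (c s) hx)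
    refine h1.congr_of_eventuallyEq ?_
    have h2 : ∀ᶠ r in 𝓝 s, ContMDiffAt 𝓘(ℝ, ℝ) I 1 c r :=
      (contMDiffAt_iff_contMDiffAt_nhds (by simp)).1 ((hc s hs).1.of_le (by simp))
    filter_upwards [h2, hc.eventually_mem_source hs hx] with r hr hr'
    exact norm_mfderiv_sq I (hr.mdifferentiableAt (by simp)) hr' 1
  have h := constant_of_has_deriv_right_zero
    (fun s hs ↦ (hd s hs).continuousAt.continuousWithinAt)
    (fun s hs ↦ (hd s (Ico_subset_Icc_self hs)).hasDerivWithinAt) t ht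
  exact (sq_eq_sq₀ (norm_nonneg _) (norm_nonneg _)).1 h

end IsGeodesic

namespace IsGeodesicFrom

variable {c c' : ℝ → M} {q : M} {v : TangentSpace I q}

theorem comp_mul (hc : IsGeodesicFrom I q v c) {τ : ℝ} (hτ : τ ∈ Icc (0 : ℝ) 1) :
    IsGeodesicFrom I q (τ • v) (fun s ↦ c (τ * s)) := by
  refine ⟨hc.1.comp_mul hτ, by simpa using hc.2.1, ?_⟩
  rw [deriv_comp_mul_left τ (fun s ↦ extChartAt I q (c s)), coordVector_smul, mul_zero, hc.2.2]

variable [FiniteDimensional ℝ E] [I.Boundaryless]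
  [IsContMDiffRiemannianBundle I ∞ E (fun x : M ↦ TangentSpace I x)]

theorem norm_mfderiv_eq (hc : IsGeodesicFrom I q v c) {t : ℝ} (ht : t ∈ Icc (0 : ℝ) 1) :
    ‖mfderiv 𝓘(ℝ, ℝ) I c t (1 : ℝ)‖ = ‖v‖ := by
  rw [hc.1.norm_mfderiv_eq ht]
  have hx : c 0 ∈ (extChartAt I q).source := by
    rw [hc.2.1]; exact mem_extChartAt_source q
  have h := norm_mfderiv_sq I ((hc.1 0 (by simp)).1.mdifferentiableAt (by simp)) hx 1
  rw [fderiv_apply_one_eq_deriv, hc.2.2] at h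
  refine (sq_eq_sq₀ (norm_nonneg _) (norm_nonneg _)).1 (h.trans ?_)
  rw [hc.2.1, chartMetric_coordVector, real_inner_self_eq_norm_sq]

variable [T2Space M]

/-- Geodesics are determined by their initial velocity. -/
theorem eqOn (hc : IsGeodesicFrom I q v c) (hc' : IsGeodesicFrom I q v c') :
    EqOn c c' (Icc 0 1) := by
  have hcl : IsClosed ({t | c t = c' t} ∩ Icc (0 : ℝ) 1) := by
    have := (hc.1.continuousOn.prodMk hc'.1.continuousOn).preimage_isClosed_of_isClosed
      isClosed_Icc isClosed_diagonal
    rw [inter_comm]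
    exact this
  refine hcl.Icc_subset_of_forall_mem_nhdsGT_of_Icc_subset (by simp [hc.2.1, hc'.2.1]) ?_
  intro t ht hsub
  have ht' := Ico_subset_Icc_self ht
  have heq : c t = c' t := hsub (right_mem_Icc.2 ht.1)
  obtain ⟨x₀, hx, hderiv⟩ : ∃ x₀ : M, c t ∈ (extChartAt I x₀).source ∧
      deriv (fun s ↦ extChartAt I x₀ (c s)) t = deriv (fun s ↦ extChartAt I x₀ (c' s)) t := by
    rcases ht.1.eq_or_lt with h0 | h0
    · subst h0
      refine ⟨q, ?_, hc.2.2.trans hc'.2.2.symm⟩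
      rw [hc.2.1]; exact mem_extChartAt_source q
    · have hx := mem_extChartAt_source (I := I) (c t)
      refine ⟨c t, hx, ?_⟩
      have d1 := ((contDiffAt_extChartAt_comp (hc.1 t ht').1 hx).differentiableAt
        (by simp)).hasDerivAt.hasDerivWithinAt (s := Iic t)
      have hx' : c' t ∈ (extChartAt I (c t)).source := by rw [← heq]; exact hx
      have d2 := ((contDiffAt_extChartAt_comp (hc'.1 t ht').1 hx').differentiableAt
        (by simp)).hasDerivAt.hasDerivWithinAt (s := Iic t)
      refine (uniqueDiffWithinAt_Iic t).eq_deriv _ d1 (d2.congr_of_eventuallyEq ?_ (by rw [heq]))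
      filter_upwards [Ioc_mem_nhdsLE h0] with s hs
      rw [show c s = c' s from hsub ⟨hs.1.le, hs.2⟩]
  have hx' : c' t ∈ (extChartAt I x₀).source := heq ▸ hx
  have ev := (hc.1.eventually_mem_source ht' hx).and
    ((hc'.1.eventually_mem_source ht' hx').and (gt_mem_nhds ht.2))
  obtain ⟨ε, hε, hball⟩ := Metric.eventually_nhds_iff.1 ev
  have hmem {s : ℝ} (hs : s ∈ Ico t (t + ε)) : dist s t < ε := by
    rw [Real.dist_eq, abs_of_nonneg (by linarith [hs.1])]
    linarith [hs.2]
  have hIcc {s : ℝ} (hs : s ∈ Ico t (t + ε)) : s ∈ Icc (0 : ℝ) 1 :=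
    ⟨ht.1.trans hs.1, (hball (hmem hs)).2.2.le⟩
  have huniq := (isMetricOn_chartMetric I x₀).geodesic_unique (show t < t + ε by linarith)
    (fun s hs ↦ contDiffAt_extChartAt_comp (hc.1 s (hIcc hs)).1 (hball (hmem hs)).1)
    (fun s hs ↦ contDiffAt_extChartAt_comp (hc'.1 s (hIcc hs)).1 (hball (hmem hs)).2.1)
    (fun s hs ↦ (hc.1 s (hIcc hs)).2 x₀ (hball (hmem hs)).1)
    (fun s hs ↦ (hc'.1 s (hIcc hs)).2 x₀ (hball (hmem hs)).2.1)
    ((extChartAt I x₀).map_source hx) (by rw [heq]) hderiv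
  filter_upwards [huniq, ev.filter_mono nhdsWithin_le_nhds] with s hs hs'
  exact (extChartAt I x₀).injOn hs'.1 hs'.2.1 hs

theorem exp_smul (hc : IsGeodesicFrom I q v c) {τ : ℝ} (hτ : τ ∈ Icc (0 : ℝ) 1) :
    Exp I q (τ • v) = c τ := by
  have h : ∃ c : ℝ → M, IsGeodesicFrom I q (τ • v) c := ⟨_, hc.comp_mul hτ⟩
  rw [Exp, dif_pos h]
  simpa using h.choose_spec.eqOn (hc.comp_mul hτ) (right_mem_Icc.2 zero_le_one)

end IsGeodesicFrom

end Geodesic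

section ExpMap

variable {E : Type*} [NormedAddCommGroup E] [NormedSpace ℝ E]
  {H : Type*} [TopologicalSpace H] {I : ModelWithCorners ℝ E H}
  {M : Type*} [TopologicalSpace M] [ChartedSpace H M] [IsManifold I ∞ M]
  [RiemannianBundle (fun x : M ↦ TangentSpace I x)] {q : M} {v : TangentSpace I q}

theorem IsDiffeoOnBall.contMDiffAt_exp {a : ℝ} (h : IsDiffeoOnBall I q a)
    (hv : v ∈ Metric.ball (0 : TangentSpace I q) a) :
    ContMDiffAt 𝓘(ℝ, TangentSpace I q) I ∞ (Exp I q) v := by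
  obtain ⟨_, Φ, hs, heq, hΦ, _⟩ := h
  rw [hs] at heq hΦ
  exact (hΦ.congr fun x hx ↦ (heq hx).symm).contMDiffAt (Metric.isOpen_ball.mem_nhds hv)

theorem exists_isDiffeoOnBall (hv : ‖v‖ₑ < injectivityRadius I q) :
    ∃ a : ℝ≥0, IsDiffeoOnBall I q a ∧ v ∈ Metric.ball (0 : TangentSpace I q) a := by
  simp only [injectivityRadius, lt_iSup_iff] at hv
  obtain ⟨a, ha, hlt⟩ := hv
  refine ⟨a, ha, ?_⟩
  rw [mem_ball_zero_iff, ← coe_nnnorm]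
  exact_mod_cast hlt

theorem contMDiffAt_exp (hv : ‖v‖ₑ < injectivityRadius I q) :
    ContMDiffAt 𝓘(ℝ, TangentSpace I q) I ∞ (Exp I q) v := by
  obtain ⟨a, ha, hva⟩ := exists_isDiffeoOnBall hv
  exact ha.contMDiffAt_exp hva

variable (I q) in
/-- The region around the origin where the exponential map is smooth with values in the chart. -/
def expChartDomain (a : ℝ) : Set (TangentSpace I q) :=
  Metric.ball (0 : TangentSpace I q) a ∩ Exp I q ⁻¹' (extChartAt I q).source

theorem IsDiffeoOnBall.isOpen_expChartDomain {a : ℝ} (h : IsDiffeoOnBall I q a) :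
    IsOpen (expChartDomain I q a) :=
  ContinuousOn.isOpen_inter_preimage
    (fun _ hv ↦ (h.contMDiffAt_exp hv).continuousAt.continuousWithinAt) Metric.isOpen_ball
    (isOpen_extChartAt_source q)

theorem IsDiffeoOnBall.contDiffAt_chart_exp {a : ℝ} (h : IsDiffeoOnBall I q a)
    (hv : v ∈ expChartDomain I q a) : ContDiffAt ℝ ∞ (fun w ↦ extChartAt I q (Exp I q w)) v :=
  contDiffAt_extChartAt_comp (h.contMDiffAt_exp hv.1) hv.2

variable [FiniteDimensional ℝ E] [I.Boundaryless] [T2Space M]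
  [IsContMDiffRiemannianBundle I ∞ E (fun x : M ↦ TangentSpace I x)]

theorem exp_zero {a : ℝ} (ha : 0 < a) (h : IsDiffeoOnBall I q a) :
    Exp I q (0 : TangentSpace I q) = q := by
  obtain ⟨c, hc⟩ := h.1 (Metric.mem_ball_self ha)
  have := hc.exp_smul (τ := 0) (by simp)
  rwa [zero_smul, hc.2.1] at this

theorem IsDiffeoOnBall.geodesic_chart_exp {a : ℝ} (h : IsDiffeoOnBall I q a)
    (hv : v ∈ expChartDomain I q a) :
    fderiv ℝ (fderiv ℝ (fun w ↦ extChartAt I q (Exp I q w))) v v v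
      + christoffelCLM (chartMetric I q) (extChartAt I q (Exp I q v))
        (fderiv ℝ (fun w ↦ extChartAt I q (Exp I q w)) v v)
        (fderiv ℝ (fun w ↦ extChartAt I q (Exp I q w)) v v) = 0 := by
  set f : TangentSpace I q → E := fun w ↦ extChartAt I q (Exp I q w) with hf
  obtain ⟨l, hl, hlv⟩ : ∃ l : ℝ, 1 < l ∧ l • v ∈ Metric.ball (0 : TangentSpace I q) a := by
    have hc : Continuous fun l : ℝ ↦ l • v := by fun_prop
    have h1 : ∀ᶠ l : ℝ in 𝓝 1, l • v ∈ Metric.ball (0 : TangentSpace I q) a :=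
      hc.continuousAt.eventually_mem (Metric.isOpen_ball.mem_nhds (by simpa using hv.1))
    obtain ⟨l, hl⟩ := ((h1.filter_mono nhdsWithin_le_nhds).and
      (self_mem_nhdsWithin : Ioi (1 : ℝ) ∈ 𝓝[>] 1)).exists
    exact ⟨l, hl.2, hl.1⟩
  have hl0 : l ≠ 0 := by positivity
  have hτ : l⁻¹ ∈ Ioo (0 : ℝ) 1 := ⟨by positivity, inv_lt_one_of_one_lt₀ hl⟩
  have hτv : l⁻¹ • l • v = v := by rw [smul_smul, inv_mul_cancel₀ hl0, one_smul]
  obtain ⟨c, hc⟩ := h.1 hlv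
  have heq : (fun s ↦ extChartAt I q (c s)) =ᶠ[𝓝 l⁻¹] fun s ↦ f (s • l • v) := by
    filter_upwards [Ioo_mem_nhds hτ.1 hτ.2] with s hs
    rw [hf, ← hc.exp_smul ⟨hs.1.le, hs.2.le⟩]
  have hopen : ∀ᶠ s : ℝ in 𝓝 l⁻¹, s • l • v ∈ expChartDomain I q a := by
    have hcont : Continuous fun s : ℝ ↦ s • l • v := by fun_prop
    exact hcont.continuousAt.eventually_mem (h.isOpen_expChartDomain.mem_nhds (by rwa [hτv]))
  have hd : deriv (fun s ↦ extChartAt I q (c s)) =ᶠ[𝓝 l⁻¹]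
      fun s ↦ fderiv ℝ f (s • l • v) (l • v) := by
    filter_upwards [heq.eventuallyEq_nhds, hopen] with s hs hs'
    rw [hs.deriv_eq]
    exact (hasDerivAt_comp_smul
      ((h.contDiffAt_chart_exp hs').differentiableAt (by simp)).hasFDerivAt).deriv
  have hdd : deriv (deriv (fun s ↦ extChartAt I q (c s))) l⁻¹ =
      fderiv ℝ (fderiv ℝ f) v (l • v) (l • v) := by
    rw [hd.deriv_eq]
    have h1 : HasFDerivAt (fderiv ℝ f) (fderiv ℝ (fderiv ℝ f) v) (l⁻¹ • l • v) := by
      rw [hτv]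
      exact (((h.contDiffAt_chart_exp hv).fderiv_right (m := ∞) (by simp)).differentiableAt
        (by simp)).hasFDerivAt
    have h2 := (hasDerivAt_comp_smul h1).clm_apply (hasDerivAt_const l⁻¹ (l • v))
    simpa using h2.deriv
  have hcτ : c l⁻¹ = Exp I q v := by rw [← hc.exp_smul ⟨hτ.1.le, hτ.2.le⟩, hτv]
  have ho := (hc.1 l⁻¹ ⟨hτ.1.le, hτ.2.le⟩).2 q (by rw [hcτ]; exact hv.2)
  have hd0 : deriv (fun s ↦ extChartAt I q (c s)) l⁻¹ = fderiv ℝ f v (l • v) := by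
    refine hd.self_of_nhds.trans ?_
    simp only [hτv]
  dsimp only at ho
  rw [hdd, hd0, hcτ, ← christoffelCLM_apply] at ho
  simp only [map_smul, smul_apply, ← smul_add, smul_eq_zero, hl0, false_or] at ho
  exact ho

theorem IsDiffeoOnBall.fderiv_chart_exp_zero {a : ℝ} (ha : 0 < a) (h : IsDiffeoOnBall I q a)
    (w : TangentSpace I q) :
    fderiv ℝ (fun w ↦ extChartAt I q (Exp I q w)) 0 w = coordVector I q w := by
  set f : TangentSpace I q → E := fun w ↦ extChartAt I q (Exp I q w) with hf
  have h0 : (0 : TangentSpace I q) ∈ expChartDomain I q a :=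
    ⟨Metric.mem_ball_self ha, by
      rw [mem_preimage, exp_zero ha h]; exact mem_extChartAt_source q⟩
  obtain ⟨l, hl, hlw⟩ : ∃ l : ℝ, 0 < l ∧ l • w ∈ Metric.ball (0 : TangentSpace I q) a := by
    obtain ⟨l, hl⟩ := (((eventually_smul_mem (Metric.ball_mem_nhds _ ha) w).filter_mono
      nhdsWithin_le_nhds).and (self_mem_nhdsWithin : Ioi (0 : ℝ) ∈ 𝓝[>] 0)).exists
    exact ⟨l, hl.2, hl.1⟩
  obtain ⟨c, hc⟩ := h.1 hlw
  have h1 : HasFDerivAt f (fderiv ℝ f 0) ((0 : ℝ) • l • w) := by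
    rw [zero_smul]
    exact ((h.contDiffAt_chart_exp h0).differentiableAt (by simp)).hasFDerivAt
  have hx : c 0 ∈ (extChartAt I q).source := by
    rw [hc.2.1]; exact mem_extChartAt_source q
  have d1 := (hasDerivAt_comp_smul h1).hasDerivWithinAt (s := Ici 0)
  have d2 := ((contDiffAt_extChartAt_comp (hc.1 0 (by simp)).1 hx).differentiableAt
    (by simp)).hasDerivAt.hasDerivWithinAt (s := Ici 0)
  have heq : (fun s : ℝ ↦ f (s • l • w)) =ᶠ[𝓝[≥] 0] fun s ↦ extChartAt I q (c s) := by
    filter_upwards [Ico_mem_nhdsGE (zero_lt_one' ℝ)] with s hs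
    rw [hf, ← hc.exp_smul ⟨hs.1, hs.2.le⟩]
  have h2 := (uniqueDiffWithinAt_Ici (0 : ℝ)).eq_deriv _ d1
    (d2.congr_of_eventuallyEq heq (heq.self_of_nhdsWithin (by simp)))
  rw [hc.2.2, map_smul, coordVector_smul] at h2
  exact smul_right_injective E hl.ne' h2

theorem IsDiffeoOnBall.isExpLike {a : ℝ} (ha : 0 < a) (h : IsDiffeoOnBall I q a) :
    IsExpLike (chartMetric I q) (extChartAt I q).target
      (fun w : TangentSpace I q ↦ extChartAt I q (Exp I q w)) (expChartDomain I q a) where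
  metric := isMetricOn_chartMetric I q
  isOpen := h.isOpen_expChartDomain
  zero_mem := ⟨Metric.mem_ball_self ha, by
    rw [mem_preimage, exp_zero ha h]; exact mem_extChartAt_source q⟩
  contDiffOn _ hv := (h.contDiffAt_chart_exp hv).contDiffWithinAt
  mapsTo _ hv := (extChartAt I q).map_source hv.2
  geodesic _ hv := h.geodesic_chart_exp hv

variable (I q) in
/-- The curvature form `⟨R(w, v)v, w⟩` at `q`. -/
def curvatureForm (w v : TangentSpace I q) : ℝ :=
  chartMetric I q (extChartAt I q q) (curvature (chartMetric I q) (extChartAt I q q)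
    (coordVector I q w) (coordVector I q v) (coordVector I q v)) (coordVector I q w)

/-- Expansion of the differential of the exponential map at the origin. -/
theorem norm_mfderiv_exp_expansion (hr : 0 < injectivityRadius I q) {ε : ℝ} (hε : 0 < ε) :
    ∃ ρ > 0, ∀ v : TangentSpace I q, ‖v‖ < ρ → ∀ w : TangentSpace I q,
      |‖mfderiv 𝓘(ℝ, TangentSpace I q) I (Exp I q) v w‖ ^ 2 - ‖w‖ ^ 2
        + 1 / 3 * curvatureForm I q w v| ≤ ε * ‖v‖ ^ 2 * ‖w‖ ^ 2 := by
  obtain ⟨a, h, ha⟩ := exists_isDiffeoOnBall (I := I) (q := q) (v := 0) (by simpa using hr)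
  have ha : 0 < (a : ℝ) := by simpa using ha
  have hE := h.isExpLike ha
  obtain ⟨ρ, hρ, hb⟩ := hE.pullback_expansion hε
  obtain ⟨ρ', hρ', hb'⟩ := Metric.isOpen_iff.1 hE.isOpen 0 hE.zero_mem
  refine ⟨min ρ ρ', lt_min hρ hρ', fun v hv w ↦ ?_⟩
  have hvW : v ∈ expChartDomain I q a :=
    hb' (by rw [mem_ball_zero_iff]; exact hv.trans_le (min_le_right _ _))
  have h1 := hb v (hv.trans_le (min_le_left _ _)) w
  simp only [h.fderiv_chart_exp_zero ha, exp_zero ha h, chartMetric_coordVector,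
    real_inner_self_eq_norm_sq] at h1
  rwa [norm_mfderiv_sq I ((h.contMDiffAt_exp hvW.1).mdifferentiableAt (by simp)) hvW.2]

end ExpMap

section ContinuityOfNorm

variable {E : Type*} [NormedAddCommGroup E] [NormedSpace ℝ E] [FiniteDimensional ℝ E]
  {H : Type*} [TopologicalSpace H] {I : ModelWithCorners ℝ E H} [I.Boundaryless]
  {M : Type*} [TopologicalSpace M] [ChartedSpace H M] [IsManifold I ∞ M]
  [RiemannianBundle (fun x : M ↦ TangentSpace I x)]
  [IsContMDiffRiemannianBundle I ∞ E (fun x : M ↦ TangentSpace I x)]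

theorem continuousAt_norm_mfderiv {V : Type*} [NormedAddCommGroup V] [NormedSpace ℝ V]
    {F : V → M} {v : V} (hF : ContMDiffAt 𝓘(ℝ, V) I ∞ F v) (w : V) :
    ContinuousAt (fun p : V × V ↦ ‖mfderiv 𝓘(ℝ, V) I F p.1 p.2‖) (v, w) := by
  have hx := mem_extChartAt_source (I := I) (F v)
  have hf := contDiffAt_extChartAt_comp hF hx
  have h1 : ContinuousAt (fun p : V × V ↦
      fderiv ℝ (fun z ↦ extChartAt I (F v) (F z)) p.1 p.2) (v, w) :=
    (ContinuousAt.comp (f := Prod.fst) (x := (v, w))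
      (hf.fderiv_right (m := ∞) (by simp)).continuousAt continuousAt_fst).clm_apply continuousAt_snd
  have h2 : ContinuousAt (fun p : V × V ↦
      chartMetric I (F v) (extChartAt I (F v) (F p.1))) (v, w) :=
    ContinuousAt.comp (f := Prod.fst) (x := (v, w))
      (g := fun z ↦ chartMetric I (F v) (extChartAt I (F v) (F z)))
      (ContinuousAt.comp (f := fun z ↦ extChartAt I (F v) (F z))
        (((isMetricOn_chartMetric I (F v)).contDiffAt
        ((extChartAt I (F v)).map_source hx)).continuousAt) hf.continuousAt) continuousAt_fst
  have h3 := (Real.continuous_sqrt.continuousAt).comp ((h2.clm_apply h1).clm_apply h1)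
  refine h3.congr ?_
  have e1 : ∀ᶠ z in 𝓝 v, ContMDiffAt 𝓘(ℝ, V) I 1 F z :=
    (contMDiffAt_iff_contMDiffAt_nhds (by simp)).1 (hF.of_le (by simp))
  have e2 : ∀ᶠ z in 𝓝 v, F z ∈ (extChartAt I (F v)).source :=
    hF.continuousAt.eventually_mem ((isOpen_extChartAt_source _).mem_nhds hx)
  filter_upwards [continuousAt_fst.eventually (e1.and e2)] with p hp
  simp only [Function.comp_apply]
  rw [← norm_mfderiv_sq I (hp.1.mdifferentiableAt (by simp)) hp.2, Real.sqrt_sq (norm_nonneg _)]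

theorem continuous_curvatureForm (q : M) :
    Continuous fun p : TangentSpace I q × TangentSpace I q ↦ curvatureForm I q p.1 p.2 := by
  have hy := (extChartAt I q).map_source (mem_extChartAt_source (I := I) q)
  have hc : Continuous (coordVector I q) := ContinuousLinearMap.continuous _
  have h1 : Continuous fun p : TangentSpace I q × TangentSpace I q ↦ coordVector I q p.1 :=
    hc.comp continuous_fst
  have h2 : Continuous fun p : TangentSpace I q × TangentSpace I q ↦ coordVector I q p.2 :=
    hc.comp continuous_snd
  simp only [curvatureForm, (isMetricOn_chartMetric I q).curvature_eq hy]
  generalize fderiv ℝ (christoffelCLM (chartMetric I q)) (extChartAt I q q) = A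
  fun_prop

end ContinuityOfNorm

section Radius

variable {E : Type*} [NormedAddCommGroup E] [NormedSpace ℝ E] [FiniteDimensional ℝ E]
  {H : Type*} [TopologicalSpace H] {I : ModelWithCorners ℝ E H} [I.Boundaryless]
  {M : Type*} [TopologicalSpace M] [ChartedSpace H M] [IsManifold I ∞ M]
  [RiemannianBundle (fun x : M ↦ TangentSpace I x)]
  [IsContMDiffRiemannianBundle I ∞ E (fun x : M ↦ TangentSpace I x)] (q : M)

variable (I) in
/-- The nonnegative numbers `x` such that `d(Exp_q)` at distance `δ` from the origin stretches the
directions orthogonal to the radial one by at most `1 - K δ² / 6 + x`. -/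
def stretchBounds (δ : ℝ) : Set ℝ :=
  {x | 0 ≤ x ∧ ∀ e n : TangentSpace I q, ‖e‖ = 1 → ‖n‖ = 1 →
    ‖mfderiv 𝓘(ℝ, TangentSpace I q) I (Exp I q) (δ • e) n‖
      ≤ 1 - curvatureForm I q n e / 6 * δ ^ 2 + x}

variable (I) in
/-- The smallest element of `stretchBounds`. -/
def stretchError (δ : ℝ) : ℝ := sInf (stretchBounds I q δ)

variable {q}

theorem stretchBounds_nonempty {δ : ℝ} (hδ : 0 ≤ δ)
    (hr : ENNReal.ofReal δ < injectivityRadius I q) : (stretchBounds I q δ).Nonempty := by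
  have : FiniteDimensional ℝ (TangentSpace I q) := inferInstanceAs (FiniteDimensional ℝ E)
  have : ProperSpace (TangentSpace I q) := FiniteDimensional.proper_real _
  let G : TangentSpace I q × TangentSpace I q → ℝ := fun p ↦
    ‖mfderiv 𝓘(ℝ, TangentSpace I q) I (Exp I q) (δ • p.1) p.2‖
      + curvatureForm I q p.2 p.1 / 6 * δ ^ 2
  let S := Metric.sphere (0 : TangentSpace I q) 1
  have hG : ContinuousOn G (S ×ˢ S) := by
    intro p hp
    refine ContinuousAt.continuousWithinAt (ContinuousAt.add ?_ ?_)
    · have hp1 : ‖p.1‖ = 1 := by simpa [S] using hp.1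
      have hsm : ‖δ • p.1‖ₑ < injectivityRadius I q := by
        rwa [← ofReal_norm, norm_smul, hp1, mul_one, Real.norm_of_nonneg hδ]
      have h1 := continuousAt_norm_mfderiv (contMDiffAt_exp hsm) p.2
      have h2 : Continuous fun p : TangentSpace I q × TangentSpace I q ↦ (δ • p.1, p.2) := by
        fun_prop
      exact ContinuousAt.comp (f := fun p : TangentSpace I q × TangentSpace I q ↦ (δ • p.1, p.2))
        (x := p) h1 h2.continuousAt
    · have h3 := (continuous_curvatureForm (I := I) q).comp continuous_swap
      exact ((h3.div_const 6).mul_const (δ ^ 2)).continuousAt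
  obtain ⟨B, hB⟩ := ((isCompact_sphere _ _).prod (isCompact_sphere _ _)).bddAbove_image hG
  refine ⟨|B|, abs_nonneg B, fun e n he hn ↦ ?_⟩
  have h1 : G (e, n) ≤ B := hB ⟨(e, n), ⟨by simpa [S] using he, by simpa [S] using hn⟩, rfl⟩
  have h2 := le_abs_self B
  simp only [G] at h1
  linarith

theorem norm_mfderiv_le_stretchError {δ : ℝ} (hδ : 0 ≤ δ)
    (hr : ENNReal.ofReal δ < injectivityRadius I q) {e n : TangentSpace I q}
    (he : ‖e‖ = 1) (hn : ‖n‖ = 1) :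
    ‖mfderiv 𝓘(ℝ, TangentSpace I q) I (Exp I q) (δ • e) n‖
      ≤ 1 - curvatureForm I q n e / 6 * δ ^ 2 + stretchError I q δ := by
  have h := le_csInf (stretchBounds_nonempty hδ hr) fun x hx ↦
    (sub_le_iff_le_add'.2 (hx.2 e n he hn) :
      ‖mfderiv 𝓘(ℝ, TangentSpace I q) I (Exp I q) (δ • e) n‖
        - (1 - curvatureForm I q n e / 6 * δ ^ 2) ≤ x)
  exact sub_le_iff_le_add'.1 h

theorem stretchError_isLittleO [T2Space M] (hr : 0 < injectivityRadius I q) :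
    stretchError I q =o[𝓝[>] 0] fun δ : ℝ ↦ δ ^ 2 := by
  refine Asymptotics.isLittleO_iff.2 fun ε hε ↦ ?_
  obtain ⟨ρ, hρ, hb⟩ := norm_mfderiv_exp_expansion hr (ε := 2 * ε) (by positivity)
  filter_upwards [Ioo_mem_nhdsGT hρ] with δ hδ
  have hmem : ε * δ ^ 2 ∈ stretchBounds I q δ := by
    refine ⟨by positivity, fun e n he hn ↦ ?_⟩
    have hv : ‖δ • e‖ = δ := by rw [norm_smul, he, mul_one, Real.norm_of_nonneg hδ.1.le]
    have h1 := (abs_le.1 (hb (δ • e) (by rw [hv]; exact hδ.2) n)).2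
    have hcf : curvatureForm I q n (δ • e) = δ ^ 2 * curvatureForm I q n e := by
      have hy := (extChartAt I q).map_source (mem_extChartAt_source (I := I) q)
      have := (isMetricOn_chartMetric I q).curvature_basis_change hy (coordVector I q n)
        (coordVector I q e) 1 0 0 δ
      simpa [curvatureForm, coordVector_smul] using this
    rw [hv, hn, hcf] at h1
    nlinarith [sq_nonneg (‖mfderiv 𝓘(ℝ, TangentSpace I q) I (Exp I q) (δ • e) n‖ - 1)]
  have hbdd : BddBelow (stretchBounds I q δ) := ⟨0, fun x hx ↦ hx.1⟩
  rw [stretchError, Real.norm_of_nonneg (Real.sInf_nonneg fun x hx ↦ hx.1),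
    Real.norm_of_nonneg (by positivity)]
  exact csInf_le hbdd hmem

end Radius

theorem norm_smul_add_smul_eq_one {V : Type*} [NormedAddCommGroup V] [InnerProductSpace ℝ V]
    {e n : V} (he : ‖e‖ = 1) (hn : ‖n‖ = 1) (hen : inner ℝ e n = 0) (a b : ℝ)
    (hab : a ^ 2 + b ^ 2 = 1) : ‖a • e + b • n‖ = 1 := by
  have h := norm_add_sq_real (a • e) (b • n)
  rw [real_inner_smul_left, real_inner_smul_right, hen, norm_smul, norm_smul, he, hn] at h
  refine (sq_eq_sq₀ (norm_nonneg _) zero_le_one).1 ?_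
  simpa [hab] using h

section Distance

variable {E : Type*} [NormedAddCommGroup E] [NormedSpace ℝ E]
  {H : Type*} [TopologicalSpace H] {I : ModelWithCorners ℝ E H}
  {M : Type*} [EMetricSpace M] [ChartedSpace H M]
  [RiemannianBundle (fun x : M ↦ TangentSpace I x)] [IsRiemannianManifold I M]

theorem edist_le_of_norm_mfderiv_le {γ : ℝ → M} {a b L : ℝ} (hab : a ≤ b)
    (hγ : ∀ t ∈ Icc a b, ContMDiffAt 𝓘(ℝ, ℝ) I 1 γ t)
    (hL : ∀ t ∈ Icc a b, ‖mfderiv 𝓘(ℝ, ℝ) I γ t (1 : ℝ)‖ ≤ L) :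
    edist (γ a) (γ b) ≤ ENNReal.ofReal (L * (b - a)) := by
  rw [IsRiemannianManifold.out (I := I) (γ a) (γ b)]
  refine (riemannianEDist_le_pathELength (fun t ht ↦ (hγ t ht).contMDiffWithinAt)
    rfl rfl hab).trans ?_
  rw [pathELength_eq_lintegral_mfderiv_Icc]
  have hL0 : 0 ≤ L := (norm_nonneg _).trans (hL a (left_mem_Icc.2 hab))
  calc _ ≤ ∫⁻ _ in Icc a b, ENNReal.ofReal L :=
        MeasureTheory.setLIntegral_mono' measurableSet_Icc fun t ht ↦ by
          rw [← ofReal_norm]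
          exact ENNReal.ofReal_le_ofReal (hL t ht)
    _ = _ := by
      rw [MeasureTheory.setLIntegral_const, Real.volume_Icc, ENNReal.ofReal_mul hL0]

variable [FiniteDimensional ℝ E] [I.Boundaryless] [IsManifold I ∞ M]
  [IsContMDiffRiemannianBundle I ∞ E (fun x : M ↦ TangentSpace I x)] {q : M}

/-- Points on the same geodesic ray are at most as far apart as their radii. -/
theorem edist_exp_smul_le {v : TangentSpace I q} (hv : ‖v‖ₑ < injectivityRadius I q) {τ : ℝ}
    (hτ : τ ∈ Icc (0 : ℝ) 1) :
    edist (Exp I q (τ • v)) (Exp I q v) ≤ ENNReal.ofReal (‖v‖ * (1 - τ)) := by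
  obtain ⟨a, h, hva⟩ := exists_isDiffeoOnBall hv
  obtain ⟨c, hc⟩ := h.1 hva
  have h1 : Exp I q v = c 1 := by
    simpa using hc.exp_smul (τ := 1) (by simp)
  rw [h1, hc.exp_smul hτ]
  have hsub {t : ℝ} (ht : t ∈ Icc τ 1) : t ∈ Icc (0 : ℝ) 1 := ⟨hτ.1.trans ht.1, ht.2⟩
  exact edist_le_of_norm_mfderiv_le (I := I) hτ.2
    (fun t ht ↦ (hc.1 t (hsub ht)).1.of_le (by simp))
    (fun t ht ↦ (hc.norm_mfderiv_eq (hsub ht)).le)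

theorem edist_exp_ray_le {e : TangentSpace I q} (he : ‖e‖ = 1) {r s : ℝ} (hr : 0 < r) (hs : 0 < s)
    (hr' : ENNReal.ofReal r < injectivityRadius I q)
    (hs' : ENNReal.ofReal s < injectivityRadius I q) :
    edist (Exp I q (r • e)) (Exp I q (s • e)) ≤ ENNReal.ofReal |r - s| := by
  wlog hrs : r ≤ s generalizing r s
  · rw [edist_comm, abs_sub_comm]
    exact this hs hr hs' hr' (le_of_not_ge hrs)
  have hn : ‖s • e‖ = s := by rw [norm_smul, he, mul_one, Real.norm_of_nonneg hs.le]
  have h := edist_exp_smul_le (v := s • e) (by rwa [← ofReal_norm, hn])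
    (τ := r / s) ⟨by positivity, (div_le_one hs).2 hrs⟩
  rw [smul_smul, div_mul_cancel₀ _ hs.ne', hn] at h
  refine h.trans_eq ?_
  rw [abs_of_nonpos (by linarith)]
  congr 1
  field_simp
  ring

/-- Estimate of the length of the image under the exponential map of a circular arc. -/
theorem edist_exp_arc_le {e n : TangentSpace I q} (he : ‖e‖ = 1) (hn : ‖n‖ = 1)
    (hen : inner ℝ e n = 0) {δ θ : ℝ} (hδ : 0 ≤ δ) (hθ : 0 ≤ θ)
    (hr : ENNReal.ofReal δ < injectivityRadius I q) :
    edist (Exp I q (δ • e)) (Exp I q (δ • (Real.cos θ • e + Real.sin θ • n))) ≤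
      ENNReal.ofReal (θ * δ * (1 - curvatureForm I q e n / 6 * δ ^ 2 + stretchError I q δ)) := by
  let p : ℝ → TangentSpace I q := fun s ↦ Real.cos s • e + Real.sin s • n
  let p' : ℝ → TangentSpace I q := fun s ↦ -Real.sin s • e + Real.cos s • n
  have hnorm := @norm_smul_add_smul_eq_one _ _ _ _ _ he hn hen
  have hp (s : ℝ) : ‖p s‖ = 1 := hnorm _ _ (Real.cos_sq_add_sin_sq s)
  have hp' (s : ℝ) : ‖p' s‖ = 1 := hnorm _ _ (by rw [neg_sq]; exact Real.sin_sq_add_cos_sq s)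
  have hcf (s : ℝ) : curvatureForm I q (p' s) (p s) = curvatureForm I q e n := by
    have hy := (extChartAt I q).map_source (mem_extChartAt_source (I := I) q)
    have h := (isMetricOn_chartMetric I q).curvature_basis_change hy (coordVector I q e)
      (coordVector I q n) (-Real.sin s) (Real.cos s) (Real.cos s) (Real.sin s)
    have hs : (-Real.sin s * Real.sin s - Real.cos s * Real.cos s) ^ 2 = 1 := by
      have := Real.sin_sq_add_cos_sq s
      rw [show -Real.sin s * Real.sin s - Real.cos s * Real.cos s
        = -(Real.sin s ^ 2 + Real.cos s ^ 2) by ring, this]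
      norm_num
    rw [hs, one_mul] at h
    have hadd (x y : TangentSpace I q) :
        coordVector I q (x + y) = coordVector I q x + coordVector I q y := by simp [coordVector]
    simpa only [curvatureForm, p, p', hadd, coordVector_smul] using h
  have hd (s : ℝ) : HasDerivAt (fun s ↦ δ • p s) (δ • p' s) s := by
    have h1 := (Real.hasDerivAt_cos s).smul_const e
    have h2 := (Real.hasDerivAt_sin s).smul_const n
    exact (h1.add h2).const_smul δ
  have hsmooth (s : ℝ) : ContMDiffAt 𝓘(ℝ, TangentSpace I q) I ∞ (Exp I q) (δ • p s) := by
    apply contMDiffAt_exp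
    rwa [← ofReal_norm, norm_smul, hp, mul_one, Real.norm_of_nonneg hδ]
  have hpc : ContDiff ℝ 1 (fun s ↦ δ • p s) :=
    ((Real.contDiff_cos.smul contDiff_const).add
      (Real.contDiff_sin.smul contDiff_const)).const_smul δ
  have h := edist_le_of_norm_mfderiv_le (I := I) (γ := fun s ↦ Exp I q (δ • p s))
    (L := δ * (1 - curvatureForm I q e n / 6 * δ ^ 2 + stretchError I q δ)) hθ
    (fun s _ ↦ ((hsmooth s).of_le (by simp)).comp s hpc.contMDiff.contMDiffAt)
    (fun s _ ↦ by
      have h1 := mfderiv_comp_apply s ((hsmooth s).mdifferentiableAt (by simp))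
        (hd s).differentiableAt.mdifferentiableAt (1 : ℝ)
      have h2 : mfderiv 𝓘(ℝ, ℝ) 𝓘(ℝ, TangentSpace I q) (fun s ↦ δ • p s) s (1 : ℝ)
          = δ • p' s := by
        rw [mfderiv_eq_fderiv]
        exact (hd s).deriv
      rw [h2] at h1
      have h3 := norm_mfderiv_le_stretchError hδ hr (hp s) (hp' s)
      rw [hcf] at h3
      calc _ = ‖δ • mfderiv 𝓘(ℝ, TangentSpace I q) I (Exp I q) (δ • p s) (p' s)‖ := by
            refine (congrArg norm h1).trans ?_
            exact congrArg norm (map_smul _ _ _)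
        _ ≤ _ := by
            rw [norm_smul, Real.norm_of_nonneg hδ]
            exact mul_le_mul_of_nonneg_left h3 hδ)
  simp only [p, Real.cos_zero, Real.sin_zero, one_smul, zero_smul, add_zero, sub_zero] at h
  refine h.trans_eq ?_
  congr 1
  ring

end Distance

section Plane

variable {V : Type*} [NormedAddCommGroup V] [InnerProductSpace ℝ V] {x y : V}

open InnerProductGeometry in
theorem sin_angle_pos_of_linearIndependent (h : LinearIndependent ℝ ![x, y]) :
    0 < Real.sin (angle x y) := by
  have hx : x ≠ 0 := h.ne_zero 0
  have hp := (LinearIndependent.pair_iff' hx).1 h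
  refine Real.sin_pos_of_pos_of_lt_pi ((angle_nonneg x y).lt_of_ne' fun h0 ↦ ?_)
    ((angle_le_pi x y).lt_of_ne fun hpi ↦ ?_)
  · obtain ⟨_, r, _, hr⟩ := angle_eq_zero_iff.1 h0
    exact hp r hr.symm
  · obtain ⟨_, r, _, hr⟩ := angle_eq_pi_iff.1 hpi
    exact hp r hr.symm

open InnerProductGeometry in
/-- Polar coordinates of two linearly independent vectors in the plane that they span. -/
theorem exists_orthonormal_of_linearIndependent (h : LinearIndependent ℝ ![x, y]) :
    ∃ e n : V, ‖e‖ = 1 ∧ ‖n‖ = 1 ∧ inner ℝ e n = 0 ∧ x = ‖x‖ • e ∧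
      y = ‖y‖ • (Real.cos (angle x y) • e + Real.sin (angle x y) • n) := by
  have hx : ‖x‖ ≠ 0 := norm_ne_zero_iff.2 (h.ne_zero 0)
  have hy : ‖y‖ ≠ 0 := norm_ne_zero_iff.2 (h.ne_zero 1)
  have hs := (sin_angle_pos_of_linearIndependent h).ne'
  set θ := angle x y with hθ
  set e := ‖x‖⁻¹ • x with he
  set f := ‖y‖⁻¹ • y with hf
  have hne : ‖e‖ = 1 := by rw [he, norm_smul, norm_inv, norm_norm, inv_mul_cancel₀ hx]
  have hnf : ‖f‖ = 1 := by rw [hf, norm_smul, norm_inv, norm_norm, inv_mul_cancel₀ hy]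
  have hef : inner ℝ e f = Real.cos θ := by
    rw [he, hf, real_inner_smul_left, real_inner_smul_right, hθ, cos_angle]
    field_simp
  have hxe : x = ‖x‖ • e := by rw [he, smul_smul, mul_inv_cancel₀ hx, one_smul]
  have hyf : y = ‖y‖ • f := by rw [hf, smul_smul, mul_inv_cancel₀ hy, one_smul]
  clear_value e f
  have hnorm : ‖f - Real.cos θ • e‖ ^ 2 = Real.sin θ ^ 2 := by
    rw [norm_sub_sq_real, real_inner_smul_right, real_inner_comm, hef, norm_smul, hne, hnf,
      mul_one, Real.norm_eq_abs, sq_abs, Real.sin_sq]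
    ring
  refine ⟨e, (Real.sin θ)⁻¹ • (f - Real.cos θ • e), hne, ?_, ?_, ?_, ?_⟩
  · refine (sq_eq_sq₀ (norm_nonneg _) zero_le_one).1 ?_
    rw [norm_smul, mul_pow, hnorm, Real.norm_eq_abs, sq_abs]
    field_simp
  · rw [real_inner_smul_right, inner_sub_right, real_inner_smul_right, hef,
      real_inner_self_eq_norm_sq, hne]
    ring
  · exact hxe
  · rwa [smul_smul, mul_inv_cancel₀ hs, one_smul, add_sub_cancel]

end Plane

variable {E : Type*} [NormedAddCommGroup E] [NormedSpace ℝ E] [FiniteDimensional ℝ E]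
  {H : Type*} [TopologicalSpace H] {I : ModelWithCorners ℝ E H} [I.Boundaryless]
  {M : Type*} [TopologicalSpace M] [ChartedSpace H M] [IsManifold I ∞ M]
  [RiemannianBundle (fun x : M ↦ TangentSpace I x)]
  [IsContMDiffRiemannianBundle I ∞ E (fun x : M ↦ TangentSpace I x)] {q : M}

/-- The sectional curvature in terms of an orthonormal basis of the plane. -/
theorem sectionalCurvature_eq {e n : TangentSpace I q} (he : ‖e‖ = 1) (hn : ‖n‖ = 1)
    (hen : inner ℝ e n = 0) {a b c d : ℝ} (hdet : a * d - b * c ≠ 0) :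
    sectionalCurvature I q (a • e + b • n) (c • e + d • n) = curvatureForm I q e n := by
  have hy := (extChartAt I q).map_source (mem_extChartAt_source (I := I) q)
  have h := (isMetricOn_chartMetric I q).curvature_basis_change hy (coordVector I q e)
    (coordVector I q n) a b c d
  have hadd (a b : ℝ) : coordVector I q (a • e + b • n) =
      a • coordVector I q e + b • coordVector I q n := by simp [coordVector]
  have hin (a b c d : ℝ) : inner ℝ (a • e + b • n) (c • e + d • n) = a * c + b * d := by
    simp only [inner_add_left, inner_add_right, real_inner_smul_left, real_inner_smul_right,
      real_inner_self_eq_norm_sq, he, hn, hen, real_inner_comm e n]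
    ring
  rw [sectionalCurvature, coordSectionalCurvature, chartMetric_coordVector,
    chartMetric_coordVector, chartMetric_coordVector, hin, hin, hin, hadd, hadd, h,
    div_eq_iff (by
      rw [show (a * a + b * b) * (c * c + d * d) - (a * c + b * d) ^ 2 = (a * d - b * c) ^ 2 by
        ring]
      exact pow_ne_zero 2 hdet), curvatureForm]
  ring

end RiemannianGeometry

end

theorem theorem3p1
    {E : Type*} [NormedAddCommGroup E] [NormedSpace ℝ E] [FiniteDimensional ℝ E]
    {H : Type*} [TopologicalSpace H] (I : ModelWithCorners ℝ E H) [I.Boundaryless]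
    {M : Type*} [EMetricSpace M] [ChartedSpace H M] [IsManifold I ∞ M]
    [RiemannianBundle (fun x : M ↦ TangentSpace I x)]
    [IsContMDiffRiemannianBundle I ∞ E (fun x : M ↦ TangentSpace I x)]
    [IsRiemannianManifold I M] (q : M) :
    ∃ (η : ℝ → ℝ) (C : ℝ), η =o[𝓝[>] 0] (fun δ : ℝ ↦ δ ^ 2) ∧
      ∀ Δ Δ' : TangentSpace I q,
        LinearIndependent ℝ ![Δ, Δ'] →
        ‖Δ‖ < 1 → ‖Δ'‖ < 1 →
        ‖Δ‖ₑ < RiemannianGeometry.injectivityRadius I q →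
        ‖Δ'‖ₑ < RiemannianGeometry.injectivityRadius I q →
        edist (RiemannianGeometry.Exp I q Δ) (RiemannianGeometry.Exp I q Δ') ≠ ⊤ ∧
        (edist (RiemannianGeometry.Exp I q Δ) (RiemannianGeometry.Exp I q Δ')).toReal ≤
          |‖Δ‖ - ‖Δ'‖|
            + InnerProductGeometry.angle Δ Δ' * ‖Δ‖ *
                (1 - RiemannianGeometry.sectionalCurvature I q Δ Δ' / 6 * ‖Δ‖ ^ 2 + η ‖Δ‖)
            + C * InnerProductGeometry.angle Δ Δ' ^ 2 := by
  open RiemannianGeometry in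
  rcases (zero_le (a := injectivityRadius I q)).eq_or_lt with hr | hr
  · refine ⟨fun _ ↦ 0, 0, Asymptotics.isLittleO_zero _ _, fun Δ Δ' _ _ _ h ↦ ?_⟩
    rw [← hr] at h
    exact absurd h not_lt_zero
  refine ⟨stretchError I q, 0, stretchError_isLittleO hr, fun Δ Δ' hli _ _ h h' ↦ ?_⟩
  have hδ : 0 < ‖Δ‖ := norm_pos_iff.2 (hli.ne_zero 0)
  have hδ' : 0 < ‖Δ'‖ := norm_pos_iff.2 (hli.ne_zero 1)
  have hs := sin_angle_pos_of_linearIndependent hli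
  obtain ⟨e, n, he, hn, hen, hx, hy⟩ := exists_orthonormal_of_linearIndependent hli
  rw [← ofReal_norm] at h h'
  have hθ := InnerProductGeometry.angle_nonneg Δ Δ'
  generalize InnerProductGeometry.angle Δ Δ' = θ at *
  generalize ‖Δ‖ = δ at *
  generalize ‖Δ'‖ = δ' at *
  have hK : sectionalCurvature I q Δ Δ' = curvatureForm I q e n := by
    have := sectionalCurvature_eq he hn hen (a := δ) (b := 0) (c := δ' * Real.cos θ)
      (d := δ' * Real.sin θ) (by simpa using ⟨hδ.ne', hδ'.ne', hs.ne'⟩)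
    rwa [zero_smul, add_zero, ← hx, mul_smul, mul_smul, ← smul_add, ← hy] at this
  have hf := norm_smul_add_smul_eq_one he hn hen _ _ (Real.cos_sq_add_sin_sq θ)
  have harc := edist_exp_arc_le he hn hen hδ.le hθ h
  have hrad := edist_exp_ray_le hf hδ hδ' h h'
  rw [← hx, ← hK] at harc
  rw [← hy] at hrad
  have hle := (edist_triangle _ _ _).trans (add_le_add harc hrad)
  have hnn : 0 ≤ θ * δ * (1 - sectionalCurvature I q Δ Δ' / 6 * δ ^ 2 + stretchError I q δ) := by
    have h3 := norm_mfderiv_le_stretchError (I := I) hδ.le h hn he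
    rw [← hK] at h3
    have := (norm_nonneg _).trans h3
    positivity
  rw [← ENNReal.ofReal_add hnn (abs_nonneg _)] at hle
  refine ⟨ne_top_of_le_ne_top ENNReal.ofReal_ne_top hle, ?_⟩
  refine (ENNReal.toReal_le_of_le_ofReal (add_nonneg hnn (abs_nonneg _)) hle).trans ?_
  rw [zero_mul, add_zero, add_comm]
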